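/- Let $X_1, X_2, \dots$ be independent, identically distributed real random variables whose common distribution function $F$ is absolutely continuous, with probability density $f$, and suppose that the varextropy $$VJ(X)=\operatorname{Var}\left(-\tfrac12 f(X)\right)=\tfrac14\int f^3(x)\,dx-\tfrac14\left[\int f^2(x)\,dx\right]^2$$ is finite, i.e. $E[f(X_1)^2]=\int f^3(x)\,dx<\infty$. Let $X_{1:n}\le\dots\le X_{n:n}$ be the order statistics of $X_1,\dots,X_n$, with the convention $X_{j:n}=X_{1:n}$ for $j<1$ and $X_{j:n}=X_{n:n}$ for $j>n$. For a window size $m$ (a positive integer less than $n/2$) put $$\widehat{\Delta}_2=\frac{1}{4n}\sum_{i=1}^{n}\left(\frac{c_i m/n}{X_{i+m:n}-X_{i-m:n}}\right)^{2}-\frac14\left[\frac1n\sum_{i=1}^{n}\frac{c_i m/n}{X_{i+m:n}-X_{i-m:n}}\right]^2,$$ where $c_i=1+\frac{i-1}{m}$ for $1\le i\le m$, $c_i=2$ for $m+1\le i\le n-m$, and $c_i=1+\frac{n-i}{m}$ for $n-m+1\le i\le n$. Then, for every sequence $m=m(n)$ of window sizes, $\widehat{\Delta}_2$ converges in probability to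 $VJ(X)$ as $n\to\infty$, $m\to\infty$ and $m/n\to0$. -/

import Mathlib

open MeasureTheory ProbabilityTheory Filter Topology

noncomputable section

/-- The varextropy `VJ(X) = Var(-f(X)/2)` of a real random variable `X` with Lebesgue
density `f = pdf X P volume`. -/
def varextropy {Ω : Type*} [MeasurableSpace Ω] (X : Ω → ℝ) (P : Measure Ω) : ℝ :=
  variance (fun ω => -(1 / 2) * (pdf X P volume (X ω)).toReal) P

/-- The `k`-th order statistic `X_{k:n}` (`k` counted from 1) of the sample `x`, with the
convention that `X_{k:n} = X_{1:n}` for `k < 1` and `X_{k:n} = X_{n:n}` for `k > n`.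
(For the empty sample the value is `0`.) -/
def orderStat {n : ℕ} (x : Fin n → ℝ) (k : ℕ) : ℝ :=
  if h : 0 < n then x (Tuple.sort x ⟨min (k - 1) (n - 1), by omega⟩) else 0

/-- The boundary weights `c_i`, `1 ≤ i ≤ n`, for window size `m`. -/
def spacingWeight (n m i : ℕ) : ℝ :=
  if i ≤ m then 1 + ((i : ℝ) - 1) / m
  else if i + m ≤ n then 2
  else 1 + ((n : ℝ) - i) / m

/-- The weighted spacing quotient `(c_i m / n) / (X_{i+m:n} - X_{i-m:n})`. The truncated
difference `i - m` is harmless: for `i ≤ m` the convention gives `X_{i-m:n} = X_{1:n}`. -/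
def spacingQuotient (n m : ℕ) (x : Fin n → ℝ) (i : ℕ) : ℝ :=
  (spacingWeight n m i * m / n) / (orderStat x (i + m) - orderStat x (i - m))

/-- The modified spacing estimator of the varextropy, sample size `n`, window size `m`. -/
def spacingEstimator (n m : ℕ) (x : Fin n → ℝ) : ℝ :=
  1 / (4 * (n : ℝ)) * ∑ i ∈ Finset.Icc 1 n, spacingQuotient n m x i ^ 2
    - 1 / 4 * (1 / (n : ℝ) * ∑ i ∈ Finset.Icc 1 n, spacingQuotient n m x i) ^ 2

end

/-- The spacing quotient attached to the `j`-th sample point, i.e. taken at the rank of `x j`. -/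
noncomputable def pointQuotient (n m : ℕ) (x : Fin n → ℝ) (j : Fin n) : ℝ :=
  spacingQuotient n m x (((Tuple.sort x).symm j : ℕ) + 1)

theorem sum_spacingQuotient (n m : ℕ) (x : Fin n → ℝ) (φ : ℝ → ℝ) :
    ∑ i ∈ Finset.Icc 1 n, φ (spacingQuotient n m x i) = ∑ j, φ (pointQuotient n m x j) := by
  have h1 : ∑ i ∈ Finset.Icc 1 n, φ (spacingQuotient n m x i)
      = ∑ p : Fin n, φ (spacingQuotient n m x ((p : ℕ) + 1)) := by
    rw [← Finset.sum_range fun p => φ (spacingQuotient n m x (p + 1)), Finset.range_eq_Ico,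
      Finset.sum_Ico_add' (fun i => φ (spacingQuotient n m x i)) 0 n 1]
    rfl
  rw [h1]
  exact (Equiv.sum_comp (Tuple.sort x).symm
    fun p : Fin n => φ (spacingQuotient n m x ((p : ℕ) + 1))).symm

theorem orderStat_succ {N : ℕ} (x : Fin (N + 1) → ℝ) (k : ℕ) :
    orderStat x (k + 1) = x (Tuple.sort x ⟨min k N, by omega⟩) := by
  simp [orderStat]

theorem orderStat_sub {N m : ℕ} (x : Fin (N + 1) → ℝ) (p : Fin (N + 1)) :
    orderStat x ((p : ℕ) + 1 - m) = x (Tuple.sort x ⟨p - m, by omega⟩) := by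
  rw [orderStat, dif_pos (Nat.succ_pos N)]
  congr 3
  omega

theorem pointQuotient_eq {N m : ℕ} (hm : 0 < m) (h2 : 2 * m < N + 1) (x : Fin (N + 1) → ℝ)
    (j p : Fin (N + 1)) (hp : (Tuple.sort x).symm j = p) :
    pointQuotient (N + 1) m x j =
      (((min (p + m) N - (p - m) : ℕ) : ℝ) / (N + 1 : ℕ)) /
        (x (Tuple.sort x ⟨min (p + m) N, by omega⟩) - x (Tuple.sort x ⟨p - m, by omega⟩)) := by
  have hm' : (m : ℝ) ≠ 0 := by positivity
  have hpN : (p : ℕ) ≤ N := by omega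
  rw [pointQuotient, hp, spacingQuotient, orderStat_sub, add_right_comm, orderStat_succ]
  congr 2
  unfold spacingWeight
  split_ifs with h h'
  · rw [min_eq_left (by omega), Nat.sub_eq_zero_of_le (by omega : (p : ℕ) ≤ m),
      Nat.sub_zero]
    push_cast
    field_simp
    ring
  · rw [min_eq_left (by omega), show (p + m - (p - m) : ℕ) = 2 * m by omega]
    push_cast
    ring
  · rw [min_eq_right (by omega)]
    have e : ((N - (p - m) : ℕ) : ℝ) = (N : ℝ) - ((p : ℝ) - m) := by
      rw [Nat.cast_sub (by omega), Nat.cast_sub (by omega)]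
    rw [e]
    push_cast
    field_simp
    ring

open scoped Classical in
/-- The number of coordinates of `y` lying in `A`. -/
noncomputable def hitCount {N : ℕ} (A : Set ℝ) (y : Fin N → ℝ) : ℕ :=
  (Finset.univ.filter fun l => y l ∈ A).card

open scoped Classical in
theorem hitCount_removeNth {N : ℕ} (A : Set ℝ) (x : Fin (N + 1) → ℝ)
    (j : Fin (N + 1)) :
    hitCount A (j.removeNth x) = (Finset.univ.filter fun q : Fin (N + 1) =>
      q ≠ (Tuple.sort x).symm j ∧ x (Tuple.sort x q) ∈ A).card := by
  classical
  rw [hitCount]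
  refine Finset.card_bij (fun l _ => (Tuple.sort x).symm (j.succAbove l)) ?_ ?_ ?_
  · intro l hl
    rw [Finset.mem_filter] at hl ⊢
    simpa [Fin.removeNth] using hl.2
  · intro l _ l' _ h
    simpa using h
  · intro q hq
    simp only [Finset.mem_filter, Finset.mem_univ, true_and] at hq
    obtain ⟨l, hl⟩ := Fin.exists_succAbove_eq (x := Tuple.sort x q) (y := j)
      (fun h => hq.1 (by rw [← h, Equiv.symm_apply_apply]))
    exact ⟨l, by rw [Finset.mem_filter]; simpa [Fin.removeNth, hl] using hq.2, by simp [hl]⟩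

/-- If `s` is a set of ranks other than that of `x j` whose points lie in `A`, then `A` is hit at
least `s.card` times by the other points. -/
theorem card_le_hitCount {N : ℕ} {A : Set ℝ} {x : Fin (N + 1) → ℝ} {j : Fin (N + 1)}
    (s : Finset (Fin (N + 1)))
    (hs : ∀ q ∈ s, q ≠ (Tuple.sort x).symm j ∧ x (Tuple.sort x q) ∈ A) :
    s.card ≤ hitCount A (j.removeNth x) := by
  classical
  rw [hitCount_removeNth]
  exact Finset.card_le_card fun q hq => by simpa using hs q hq

theorem hitCount_le_card {N : ℕ} {A : Set ℝ} {x : Fin (N + 1) → ℝ} {j : Fin (N + 1)}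
    (s : Finset (Fin (N + 1)))
    (hs : ∀ q, q ≠ (Tuple.sort x).symm j → x (Tuple.sort x q) ∈ A → q ∈ s) :
    hitCount A (j.removeNth x) ≤ s.card := by
  classical
  rw [hitCount_removeNth]
  exact Finset.card_le_card fun q hq => by
    simp only [Finset.mem_filter, Finset.mem_univ, true_and] at hq
    exact hs q hq.1 hq.2

theorem sort_mono {N : ℕ} (x : Fin (N + 1) → ℝ) {a b : ℕ} (hab : a ≤ b) (hb : b < N + 1) :
    x (Tuple.sort x ⟨a, hab.trans_lt hb⟩) ≤ x (Tuple.sort x ⟨b, hb⟩) :=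
  Tuple.monotone_sort x (show (⟨a, hab.trans_lt hb⟩ : Fin (N + 1)) ≤ ⟨b, hb⟩ from hab)

theorem le_hitCount_of_le_pointQuotient {N m : ℕ} (hm : 0 < m) (h2 : 2 * m < N + 1)
    (x : Fin (N + 1) → ℝ) (j : Fin (N + 1)) {t : ℝ} (ht : 0 < t)
    (h : t ≤ pointQuotient (N + 1) m x j) :
    m ≤ hitCount (Set.Icc (x j - 2 * m / ((N + 1 : ℕ) * t)) (x j + 2 * m / ((N + 1 : ℕ) * t)))
      (j.removeNth x) := by
  obtain ⟨p, hp⟩ : ∃ p, (Tuple.sort x).symm j = p := ⟨_, rfl⟩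
  have hj : Tuple.sort x p = j := by rw [← hp]; simp
  rw [pointQuotient_eq hm h2 x j p hp] at h
  have hpN : (p : ℕ) ≤ N := by omega
  set lo : ℕ := p - m with hlo
  set hi : ℕ := min (p + m) N with hhi
  have hhiN : hi < N + 1 := by omega
  have hloN : lo < N + 1 := by omega
  set D := x (Tuple.sort x ⟨hi, hhiN⟩) - x (Tuple.sort x ⟨lo, hloN⟩) with hD
  have hD0 : 0 < D := by
    by_contra hcon
    have : ((hi - lo : ℕ) : ℝ) / (N + 1 : ℕ) / D ≤ 0 :=
      div_nonpos_of_nonneg_of_nonpos (by positivity) (not_lt.1 hcon)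
    linarith
  have hn : (0 : ℝ) < (N + 1 : ℕ) := by positivity
  have hk : ((hi - lo : ℕ) : ℝ) ≤ 2 * m := by
    have : hi - lo ≤ 2 * m := by omega
    exact_mod_cast this
  have hDr : D ≤ 2 * m / ((N + 1 : ℕ) * t) := by
    rw [le_div_iff₀ hD0, le_div_iff₀ hn] at h
    rw [le_div_iff₀ (by positivity)]
    nlinarith
  have hcard : m ≤ ((Finset.Icc (⟨lo, hloN⟩ : Fin (N + 1)) ⟨hi, hhiN⟩).erase p).card := by
    rw [Finset.card_erase_of_mem, Fin.card_Icc]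
    · simp only
      omega
    · rw [Finset.mem_Icc, Fin.le_def, Fin.le_def]
      simp only
      omega
  refine hcard.trans (card_le_hitCount _ fun q hq => ?_)
  rw [Finset.mem_erase, Finset.mem_Icc] at hq
  rw [hp]
  refine ⟨hq.1, ?_⟩
  have h1 := Tuple.monotone_sort x hq.2.1
  have h3 := Tuple.monotone_sort x hq.2.2
  have h4 := Tuple.monotone_sort x
    (show (⟨lo, hloN⟩ : Fin (N + 1)) ≤ p by rw [Fin.le_def]; simp only; omega)
  have h5 := Tuple.monotone_sort x
    (show p ≤ (⟨hi, hhiN⟩ : Fin (N + 1)) by rw [Fin.le_def]; simp only; omega)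
  simp only [Function.comp_apply, hj] at h1 h3 h4 h5
  constructor <;> linarith

theorem pointQuotient_nonneg {N m : ℕ} (hm : 0 < m) (h2 : 2 * m < N + 1)
    (x : Fin (N + 1) → ℝ) (j : Fin (N + 1)) : 0 ≤ pointQuotient (N + 1) m x j := by
  rw [pointQuotient_eq hm h2 x j _ rfl]
  refine div_nonneg (by positivity) (sub_nonneg.2 (sort_mono x ?_ _))
  omega

theorem pointQuotient_mem_Icc {N m : ℕ} (hm : 0 < m) (h2 : 2 * m < N + 1)
    (x : Fin (N + 1) → ℝ) (j : Fin (N + 1)) {b₀ b₁ : ℝ} (hb₀ : 0 < b₀)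
    (hR₁ : m ≤ hitCount (Set.Ioc (x j) (x j + b₁)) (j.removeNth x))
    (hL₁ : m ≤ hitCount (Set.Ico (x j - b₁) (x j)) (j.removeNth x))
    (hR₀ : hitCount (Set.Icc (x j) (x j + b₀)) (j.removeNth x) < m)
    (hL₀ : hitCount (Set.Icc (x j - b₀) (x j)) (j.removeNth x) < m) :
    pointQuotient (N + 1) m x j ∈
      Set.Icc ((m : ℝ) / (N + 1 : ℕ) / b₁) ((m : ℝ) / (N + 1 : ℕ) / b₀) := by
  obtain ⟨p, hp⟩ : ∃ p, (Tuple.sort x).symm j = p := ⟨_, rfl⟩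
  have hj : Tuple.sort x p = j := by rw [← hp]; simp
  have hmono := Tuple.monotone_sort x
  have hlt : ∀ q r : Fin (N + 1), x (Tuple.sort x q) < x (Tuple.sort x r) → q < r := by
    intro q r h
    by_contra hcon
    exact absurd (hmono (not_lt.1 hcon)) (not_le.2 h)
  have hpN : p + m ≤ N := by
    have := hR₁.trans (hitCount_le_card (Finset.Ioi p) fun q _ hq => by
      rw [Finset.mem_Ioi]
      exact hlt _ _ (by rw [hj]; exact hq.1))
    rw [Fin.card_Ioi] at this
    omega
  have hpm : m ≤ p := by
    have := hL₁.trans (hitCount_le_card (Finset.Iio p) fun q _ hq => by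
      rw [Finset.mem_Iio]
      exact hlt _ _ (by rw [hj]; exact hq.2))
    rwa [Fin.card_Iio] at this
  have hhiN : p + m < N + 1 := by omega
  have hloN : p - m < N + 1 := by omega
  have u₁ : x (Tuple.sort x ⟨p + m, hhiN⟩) ≤ x j + b₁ := by
    by_contra! hcon
    have := hR₁.trans (hitCount_le_card (Finset.Ioo p ⟨p + m, hhiN⟩) fun q _ hq => by
      rw [Finset.mem_Ioo]
      exact ⟨hlt _ _ (by rw [hj]; exact hq.1), hlt _ _ (hq.2.trans_lt hcon)⟩)
    rw [Fin.card_Ioo] at this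
    simp only at this
    omega
  have l₁ : x j - b₁ ≤ x (Tuple.sort x ⟨p - m, hloN⟩) := by
    by_contra! hcon
    have := hL₁.trans (hitCount_le_card (Finset.Ioo ⟨p - m, hloN⟩ p) fun q _ hq => by
      rw [Finset.mem_Ioo]
      exact ⟨hlt _ _ (hcon.trans_le hq.1), hlt _ _ (by rw [hj]; exact hq.2)⟩)
    rw [Fin.card_Ioo] at this
    simp only at this
    omega
  have u₀ : x j + b₀ < x (Tuple.sort x ⟨p + m, hhiN⟩) := by
    by_contra! hcon
    refine absurd hR₀ (not_lt.2 (le_trans ?_ (card_le_hitCount (Finset.Ioc p ⟨p + m, hhiN⟩)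
      fun q hq => ?_)))
    · rw [Fin.card_Ioc]
      simp only
      omega
    · rw [Finset.mem_Ioc] at hq
      have h1 := hmono hq.1.le
      have h3 := hmono hq.2
      simp only [Function.comp_apply, hj] at h1 h3
      exact ⟨hp ▸ hq.1.ne', h1, h3.trans hcon⟩
  have l₀ : x (Tuple.sort x ⟨p - m, hloN⟩) < x j - b₀ := by
    by_contra! hcon
    refine absurd hL₀ (not_lt.2 (le_trans ?_ (card_le_hitCount (Finset.Ico ⟨p - m, hloN⟩ p)
      fun q hq => ?_)))
    · rw [Fin.card_Ico]
      simp only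
      omega
    · rw [Finset.mem_Ico] at hq
      have h1 := hmono hq.1
      have h3 := hmono hq.2.le
      simp only [Function.comp_apply, hj] at h1 h3
      exact ⟨hp ▸ hq.2.ne, hcon.trans h1, h3⟩
  rw [pointQuotient_eq hm h2 x j p hp]
  simp only [min_eq_left hpN, show (p + m - (p - m) : ℕ) = 2 * m by omega]
  set D := x (Tuple.sort x ⟨p + m, hhiN⟩) - x (Tuple.sort x ⟨p - m, hloN⟩) with hD
  have hD0 : 2 * b₀ ≤ D := by linarith
  have hD1 : D ≤ 2 * b₁ := by linarith
  have hn : (0 : ℝ) < (N + 1 : ℕ) := by positivity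
  have hm' : (0 : ℝ) < m := by positivity
  have hb₁ : 0 < b₁ := by linarith
  have hDpos : 0 < D := by linarith
  push_cast at hn ⊢
  constructor
  · rw [div_div, div_div, div_le_div_iff₀ (by positivity) (by positivity)]
    have : 0 < m * ((N : ℝ) + 1) := by positivity
    nlinarith
  · rw [div_div, div_div, div_le_div_iff₀ (by positivity) (by positivity)]
    have : 0 < m * ((N : ℝ) + 1) := by positivity
    nlinarith

theorem measurable_sort (n : ℕ) : Measurable[_, ⊤] (fun x : Fin n → ℝ => Tuple.sort x) := by
  let _ : MeasurableSpace (Equiv.Perm (Fin n)) := ⊤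
  refine measurable_to_countable' fun σ => ?_
  have : (fun x : Fin n → ℝ => Tuple.sort x) ⁻¹' {σ} = {x | (∀ i j, i ≤ j → x (σ i) ≤ x (σ j)) ∧
      ∀ i j, i < j → x (σ i) = x (σ j) → σ i < σ j} := by
    ext x
    simp only [Set.mem_preimage, Set.mem_singleton_iff, Set.mem_ofPred_eq]
    rw [eq_comm, Tuple.eq_sort_iff]
    rfl
  rw [this]
  measurability

/-- A function of the sample and of its sorting permutation is measurable as soon as it is
measurable for every fixed permutation. -/
theorem measurable_comp_sort {n : ℕ} {g : Equiv.Perm (Fin n) → (Fin n → ℝ) → ℝ}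
    (hg : ∀ σ, Measurable (g σ)) : Measurable fun x : Fin n → ℝ => g (Tuple.sort x) x := by
  have h : ∀ σ, MeasurableSet {x : Fin n → ℝ | Tuple.sort x = σ} := fun σ =>
    measurable_sort n (t := {σ}) trivial
  have e : (fun x : Fin n → ℝ => g (Tuple.sort x) x)
      = fun x => ∑ σ, {x : Fin n → ℝ | Tuple.sort x = σ}.indicator (g σ) x := by
    funext x
    rw [Finset.sum_eq_single (Tuple.sort x)]
    · exact (Set.indicator_of_mem (s := {y : Fin n → ℝ | Tuple.sort y = Tuple.sort x}) rfl _).symm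
    · exact fun σ _ hσ => Set.indicator_of_notMem (fun h => hσ h.symm) _
    · simp
  rw [e]
  exact Finset.measurable_sum _ fun σ _ => (hg σ).indicator (h σ)

theorem measurable_orderStat (n k : ℕ) : Measurable fun x : Fin n → ℝ => orderStat x k := by
  unfold orderStat
  split_ifs with h
  · exact measurable_comp_sort (g := fun σ x => x (σ ⟨min (k - 1) (n - 1), by omega⟩))
      fun _ => measurable_pi_apply _
  · exact measurable_const

theorem measurable_spacingQuotient (n m i : ℕ) :
    Measurable fun x : Fin n → ℝ => spacingQuotient n m x i :=
  measurable_const.div ((measurable_orderStat n _).sub (measurable_orderStat n _))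

theorem measurable_pointQuotient (n m : ℕ) (j : Fin n) :
    Measurable fun x : Fin n → ℝ => pointQuotient n m x j :=
  measurable_comp_sort (g := fun σ x => spacingQuotient n m x ((σ.symm j : ℕ) + 1))
    fun _ => measurable_spacingQuotient n m _

theorem measurable_hitCount {N : ℕ} {A : Set ℝ} (hA : MeasurableSet A) :
    Measurable fun y : Fin N → ℝ => hitCount A y := by
  classical
  unfold hitCount
  simp only [Finset.card_filter]
  exact Finset.measurable_sum _ fun l _ => Measurable.ite (measurable_pi_apply l hA)
    measurable_const measurable_const

theorem hitCount_eq_sum {N : ℕ} (A : Set ℝ) (y : Fin N → ℝ) :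
    (hitCount A y : ℝ) = ∑ l, A.indicator (fun _ => (1 : ℝ)) (y l) := by
  classical
  rw [hitCount, Finset.card_filter]
  push_cast
  refine Finset.sum_congr rfl fun l _ => ?_
  rw [Set.indicator_apply]

theorem pi_le_hitCount_le (μ : Measure ℝ) [IsProbabilityMeasure μ] (N m : ℕ) (A : Set ℝ) :
    Measure.pi (fun _ : Fin N => μ) {y | m ≤ hitCount A y} ≤ N.choose m * μ A ^ m := by
  classical
  have hsub : {y : Fin N → ℝ | m ≤ hitCount A y} ⊆
      ⋃ s ∈ Finset.powersetCard m (Finset.univ : Finset (Fin N)),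
        Set.pi Set.univ fun l => if l ∈ s then A else Set.univ := by
    intro y hy
    obtain ⟨s, hs, hcard⟩ := Finset.exists_subset_card_eq
      (show m ≤ (Finset.univ.filter fun l => y l ∈ A).card by
        have : m ≤ hitCount A y := hy
        rw [hitCount] at this
        convert this)
    simp only [Set.mem_iUnion]
    refine ⟨s, Finset.mem_powersetCard.2 ⟨Finset.subset_univ _, hcard⟩, fun l _ => ?_⟩
    dsimp only
    split_ifs with h
    · exact (Finset.mem_filter.1 (hs h)).2
    · trivial
  refine (measure_mono hsub).trans ((measure_biUnion_finset_le _ _).trans ?_)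
  refine (Finset.sum_le_card_nsmul _ _ (μ A ^ m) fun s hs => ?_).trans ?_
  · rw [Measure.pi_pi]
    have : ∀ l, μ (if l ∈ s then A else Set.univ) = if l ∈ s then μ A else 1 := by
      intro l
      split_ifs <;> simp
    simp only [this]
    rw [Finset.prod_ite_mem, Finset.univ_inter, Finset.prod_const,
      (Finset.mem_powersetCard.1 hs).2]
  · rw [Finset.card_powersetCard, Finset.card_univ, Fintype.card_fin, nsmul_eq_mul]

theorem choose_mul_pow_le {N m : ℕ} (hm : 0 < m) {p : ℝ} (hp : 0 ≤ p) :
    (N.choose m : ℝ) * p ^ m ≤ (3 * N * p / m) ^ m := by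
  have hm' : (0 : ℝ) < m := by positivity
  have h1 : (N.choose m : ℝ) ≤ (N : ℝ) ^ m / m.factorial := Nat.choose_le_pow_div m N
  have h2 : (m : ℝ) ^ m / m.factorial ≤ 3 ^ m := by
    calc (m : ℝ) ^ m / m.factorial ≤ Real.exp m := Real.pow_div_factorial_le_exp _ hm'.le m
      _ = Real.exp 1 ^ m := by rw [← Real.exp_nat_mul, mul_one]
      _ ≤ 3 ^ m := by
        have := Real.exp_one_lt_d9
        gcongr
        linarith
  have hf : (0 : ℝ) < m.factorial := by positivity
  rw [div_le_iff₀ hf] at h2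
  calc (N.choose m : ℝ) * p ^ m ≤ (N : ℝ) ^ m / m.factorial * p ^ m := by gcongr
    _ ≤ (3 * N * p / m) ^ m := by
      rw [div_pow, mul_pow, mul_pow, div_mul_eq_mul_div, div_le_div_iff₀ hf (by positivity)]
      nlinarith [show 0 ≤ (N : ℝ) ^ m * p ^ m by positivity]

theorem pi_le_hitCount_le_pow_five (μ : Measure ℝ) [IsProbabilityMeasure μ] {N m : ℕ} (hm : 5 ≤ m)
    (A : Set ℝ) {p : ℝ} (hp : 0 ≤ p) (hA : μ A ≤ ENNReal.ofReal p) :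
    Measure.pi (fun _ : Fin N => μ) {y | m ≤ hitCount A y} ≤
      ENNReal.ofReal ((3 * N * p / m) ^ 5) := by
  have h0 : 0 ≤ 3 * N * p / m := by positivity
  by_cases h : 3 * N * p / m ≤ 1
  · calc _ ≤ N.choose m * μ A ^ m := pi_le_hitCount_le μ N m A
      _ ≤ N.choose m * ENNReal.ofReal p ^ m := by gcongr
      _ = ENNReal.ofReal (N.choose m * p ^ m) := by
        rw [ENNReal.ofReal_mul (by positivity), ENNReal.ofReal_pow hp, ENNReal.ofReal_natCast]
      _ ≤ _ := by
        refine ENNReal.ofReal_le_ofReal ((choose_mul_pow_le (by omega) hp).trans ?_)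
        exact pow_le_pow_of_le_one h0 h hm
  · refine prob_le_one.trans ?_
    rw [ENNReal.one_le_ofReal]
    exact one_le_pow₀ (not_le.1 h).le

theorem pi_abs_hitCount_sub_le (μ : Measure ℝ) [IsProbabilityMeasure μ] (N : ℕ) {A : Set ℝ}
    (hA : MeasurableSet A) {δ : ℝ} (hδ : 0 < δ) :
    Measure.pi (fun _ : Fin N => μ) {y | δ ≤ |(hitCount A y : ℝ) - N * μ.real A|} ≤
      ENNReal.ofReal (N * μ.real A / δ ^ 2) := by
  set ν := Measure.pi fun _ : Fin N => μ with hν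
  set I : ℝ → ℝ := A.indicator fun _ => 1 with hI
  have hIm : Measurable I := measurable_const.indicator hA
  have hI2 : MemLp I 2 μ := memLp_indicator_const 2 hA 1 (Or.inr (measure_ne_top _ _))
  have hmp : ∀ l : Fin N, MeasurePreserving (Function.eval l) ν μ := fun l =>
    measurePreserving_eval _ l
  have hlp : ∀ l : Fin N, MemLp (fun y : Fin N → ℝ => I (y l)) 2 ν := fun l =>
    hI2.comp_measurePreserving (hmp l)
  have hint : ∀ l : Fin N, ∫ y, I (y l) ∂ν = μ.real A := fun l => by
    rw [hν, integral_comp_eval (μ := fun _ : Fin N => μ) hIm.aestronglyMeasurable, hI,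
      integral_indicator_const _ hA, smul_eq_mul, mul_one]
  have hvar : ∀ l : Fin N, variance (fun y : Fin N → ℝ => I (y l)) ν ≤ μ.real A := fun l => by
    refine (variance_le_expectation_sq (hlp l).aestronglyMeasurable).trans ?_
    have hsq : (fun y : Fin N → ℝ => I (y l)) ^ 2 = fun y : Fin N → ℝ => I (y l) := by
      funext y
      simp only [hI, Pi.pow_apply]
      by_cases hy : y l ∈ A <;> simp [hy]
    rw [hsq, hint]
  have hS : (fun y : Fin N → ℝ => (hitCount A y : ℝ)) = ∑ l, fun y : Fin N → ℝ => I (y l) := by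
    funext y
    rw [hitCount_eq_sum, Finset.sum_apply]
  have hSlp : MemLp (fun y : Fin N → ℝ => (hitCount A y : ℝ)) 2 ν := by
    rw [hS]
    exact memLp_finsetSum' _ fun l _ => hlp l
  have hE : ∫ y, (hitCount A y : ℝ) ∂ν = N * μ.real A := by
    simp only [hitCount_eq_sum]
    rw [integral_finsetSum _ fun l _ => (hlp l).integrable one_le_two]
    simp [hint]
  have hV : variance (fun y : Fin N → ℝ => (hitCount A y : ℝ)) ν ≤ N * μ.real A := by
    have hind : iIndepFun (fun (l : Fin N) (y : Fin N → ℝ) => I (y l)) ν :=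
      iIndepFun_pi fun _ => hIm.aemeasurable
    rw [hS, IndepFun.variance_sum (fun l _ => hlp l) fun i _ j _ hij => hind.indepFun hij]
    refine (Finset.sum_le_card_nsmul _ _ _ fun l _ => hvar l).trans ?_
    simp
  refine le_trans ?_ ((meas_ge_le_variance_div_sq hSlp hδ).trans
    (ENNReal.ofReal_le_ofReal (by gcongr)))
  rw [hE]

/-- The centred Hardy-Littlewood maximal function of a measure on the line. -/
noncomputable def maximalAverage (μ : Measure ℝ) (a : ℝ) : ENNReal :=
  ⨆ r : {r : ℝ // 0 < r}, μ (Metric.closedBall a r) / ENNReal.ofReal (2 * r)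

theorem measure_closedBall_le_maximalAverage (μ : Measure ℝ) (a : ℝ) {r : ℝ} (hr : 0 < r) :
    μ (Metric.closedBall a r) ≤ maximalAverage μ a * ENNReal.ofReal (2 * r) := by
  rw [← ENNReal.div_le_iff_le_mul (Or.inl (by simpa using hr)) (Or.inl ENNReal.ofReal_ne_top)]
  exact le_iSup (fun r : {r : ℝ // 0 < r} => μ (Metric.closedBall a r) / ENNReal.ofReal (2 * r))
    ⟨r, hr⟩

theorem lt_maximalAverage_iff {μ : Measure ℝ} {a : ℝ} {t : ENNReal} :
    t < maximalAverage μ a ↔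
      ∃ r : ℝ, 0 < r ∧ t * ENNReal.ofReal (2 * r) < μ (Metric.closedBall a r) := by
  rw [maximalAverage, lt_iSup_iff]
  constructor
  · rintro ⟨⟨r, hr⟩, h⟩
    refine ⟨r, hr, ?_⟩
    rwa [ENNReal.lt_div_iff_mul_lt (Or.inl (by simpa using hr)) (Or.inl ENNReal.ofReal_ne_top)] at h
  · rintro ⟨r, hr, h⟩
    refine ⟨⟨r, hr⟩, ?_⟩
    rwa [ENNReal.lt_div_iff_mul_lt (Or.inl (by simpa using hr)) (Or.inl ENNReal.ofReal_ne_top)]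

theorem measurable_maximalAverage (μ : Measure ℝ) : Measurable (maximalAverage μ) := by
  refine LowerSemicontinuous.measurable fun a t ht => ?_
  rcases eq_or_ne t ⊤ with rfl | htop
  · simp at ht
  obtain ⟨r, hr, h⟩ := lt_maximalAverage_iff.1 ht
  have hc : Tendsto (fun δ : ℝ => t * ENNReal.ofReal (2 * (r + δ))) (𝓝 0)
      (𝓝 (t * ENNReal.ofReal (2 * (r + 0)))) := by
    refine ENNReal.Tendsto.const_mul ?_ (Or.inr htop)
    exact (ENNReal.continuous_ofReal.comp (by fun_prop)).tendsto 0
  rw [add_zero] at hc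
  have hev := ((hc.eventually (gt_mem_nhds h)).filter_mono nhdsWithin_le_nhds).and
    (self_mem_nhdsWithin (s := Set.Ioi (0 : ℝ)))
  obtain ⟨δ, hδ, hδ0⟩ := hev.exists
  filter_upwards [Metric.ball_mem_nhds a hδ0] with b hb
  refine lt_maximalAverage_iff.2 ⟨r + δ, add_pos hr hδ0, hδ.trans_le (measure_mono ?_)⟩
  refine Metric.closedBall_subset_closedBall' ?_
  rw [Metric.mem_ball, dist_comm] at hb
  linarith

/-- The weak-type `(1, 1)` bound. -/
theorem mul_volume_lt_maximalAverage_le (ρ : Measure ℝ) [IsFiniteMeasure ρ] {t : ENNReal}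
    (ht : t ≠ 0) (ht' : t ≠ ⊤) :
    t * volume {a | t < maximalAverage ρ a} ≤ 4 * ρ Set.univ := by
  set S := {a | t < maximalAverage ρ a} with hS
  have hex : ∀ a : S, ∃ r : ℝ, 0 < r ∧ t * ENNReal.ofReal (2 * r) < ρ (Metric.closedBall a r) :=
    fun a => lt_maximalAverage_iff.1 a.2
  choose r hr0 hr using hex
  have hR : ∀ a ∈ (Set.univ : Set S), r a ≤ (ρ Set.univ / t).toReal := by
    intro a _
    have h1 : ENNReal.ofReal (2 * r a) ≤ ρ Set.univ / t := by
      rw [ENNReal.le_div_iff_mul_le (Or.inl ht) (Or.inl ht'), mul_comm]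
      exact (hr a).le.trans (measure_mono (Set.subset_univ _))
    have h2 := (ENNReal.ofReal_le_iff_le_toReal
      (ENNReal.div_ne_top (measure_ne_top ρ _) ht)).1 h1
    have := hr0 a
    linarith
  obtain ⟨u, -, hu, hcov⟩ := Vitali.exists_disjoint_subfamily_covering_enlargement_closedBall
    Set.univ (fun a : S => (a : ℝ)) r _ hR 4 (by norm_num)
  have huc : u.Countable := hu.countable_of_nonempty_interior fun a _ => by
    rw [interior_closedBall _ (hr0 a).ne']
    exact Metric.nonempty_ball.2 (hr0 a)
  have hsub : S ⊆ ⋃ b ∈ u, Metric.closedBall (b : ℝ) (4 * r b) := by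
    intro a ha
    obtain ⟨b, hb, hab⟩ := hcov ⟨a, ha⟩ (Set.mem_univ _)
    exact Set.mem_biUnion hb (hab (Metric.mem_closedBall_self (hr0 _).le))
  calc t * volume S ≤ t * ∑' b : u, volume (Metric.closedBall ((b : S) : ℝ) (4 * r b)) := by
        gcongr
        exact (measure_mono hsub).trans (measure_biUnion_le _ huc _)
    _ = ∑' b : u, 4 * (t * ENNReal.ofReal (2 * r b)) := by
        rw [← ENNReal.tsum_mul_left]
        refine tsum_congr fun b => ?_
        rw [Real.volume_closedBall, show 2 * (4 * r b) = 4 * (2 * r b) by ring,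
          ENNReal.ofReal_mul (by norm_num), mul_left_comm]
        norm_num
    _ ≤ ∑' b : u, 4 * ρ (Metric.closedBall ((b : S) : ℝ) (r b)) :=
        ENNReal.tsum_le_tsum fun b => by gcongr; exact (hr b).le
    _ = 4 * ρ (⋃ b ∈ u, Metric.closedBall (b : ℝ) (r b)) := by
        rw [ENNReal.tsum_mul_left, measure_biUnion huc hu fun b _ =>
          Metric.isClosed_closedBall.measurableSet]
    _ ≤ 4 * ρ Set.univ := by
        gcongr
        exact Set.subset_univ _

theorem mul_volume_two_mul_lt_maximalAverage_le {g : ℝ → ℝ} (hg : Measurable g) (μ : Measure ℝ)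
    [IsFiniteMeasure μ] (hμ : μ = volume.withDensity fun a => ENNReal.ofReal (g a)) {s : ℝ}
    (hs : 0 < s) :
    ENNReal.ofReal s * volume {a | ENNReal.ofReal (2 * s) < maximalAverage μ a} ≤
      4 * μ {a | s < g a} := by
  have hms : MeasurableSet {a | s < g a} := measurableSet_lt measurable_const hg
  have h := mul_volume_lt_maximalAverage_le (μ.restrict {a | s < g a}) (t := ENNReal.ofReal s)
    (by simpa using hs) ENNReal.ofReal_ne_top
  rw [Measure.restrict_apply_univ] at h
  refine le_trans (mul_le_mul_right (measure_mono fun a ha => ?_) _) h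
  obtain ⟨r, hr, hlt⟩ := lt_maximalAverage_iff.1 ha
  refine lt_maximalAverage_iff.2 ⟨r, hr, ?_⟩
  have hB : MeasurableSet (Metric.closedBall a r) := Metric.isClosed_closedBall.measurableSet
  rw [Measure.restrict_apply hB]
  have hle : μ (Metric.closedBall a r \ {a | s < g a}) ≤
      ENNReal.ofReal s * ENNReal.ofReal (2 * r) := by
    rw [hμ, withDensity_apply _ (hB.diff hms)]
    calc _ ≤ ∫⁻ _ in Metric.closedBall a r \ {a | s < g a}, ENNReal.ofReal s := by
          refine setLIntegral_mono measurable_const fun b hb => ENNReal.ofReal_le_ofReal ?_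
          exact not_lt.1 hb.2
      _ ≤ _ := by
          rw [setLIntegral_const, ← Real.volume_closedBall (a := a)]
          gcongr
          exact Set.sdiff_subset
  have hsplit := measure_inter_add_sdiff (μ := μ) (Metric.closedBall a r) hms
  rw [← hsplit, two_mul s, ENNReal.ofReal_add hs.le hs.le, add_mul] at hlt
  by_contra! hcon
  exact absurd hlt (not_lt.2 (add_le_add hcon hle))

theorem maximalAverage_lt_top_ae (μ : Measure ℝ) [IsFiniteMeasure μ] :
    ∀ᵐ a, maximalAverage μ a < ⊤ := by
  have h : ∀ k : ℕ, (k + 1 : ENNReal) * volume {a | maximalAverage μ a = ⊤} ≤ 4 * μ Set.univ := by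
    intro k
    refine le_trans ?_ (mul_volume_lt_maximalAverage_le μ (t := (k + 1 : ENNReal)) (by simp)
      (by simp))
    gcongr
    intro ha
    rw [ha]
    exact ENNReal.add_lt_top.2 ⟨by simp, by simp⟩
  have h0 : volume {a | maximalAverage μ a = ⊤} = 0 := by
    by_contra hne
    have hfin : 4 * μ Set.univ / volume {a | maximalAverage μ a = ⊤} ≠ ⊤ :=
      ENNReal.div_ne_top (ENNReal.mul_ne_top (by norm_num) (measure_ne_top _ _)) hne
    obtain ⟨k, hk⟩ := ENNReal.exists_nat_gt hfin
    rw [ENNReal.div_lt_iff (Or.inl hne)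
      (Or.inr (ENNReal.mul_ne_top (by norm_num) (measure_ne_top _ _)))] at hk
    refine absurd (h k) (not_le.2 (hk.trans_le ?_))
    gcongr
    simp
  rw [ae_iff]
  simpa using h0

theorem lintegral_maximalAverage_pow_three_le {g : ℝ → ℝ} (hg : Measurable g) (hg0 : ∀ a, 0 ≤ g a)
    (μ : Measure ℝ) [IsFiniteMeasure μ]
    (hμ : μ = volume.withDensity fun a => ENNReal.ofReal (g a)) :
    ∫⁻ a, maximalAverage μ a ^ 3 ≤ 48 * ∫⁻ a, ENNReal.ofReal (g a ^ 2) ∂μ := by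
  have hM := measurable_maximalAverage μ
  have e1 : ∫⁻ a, maximalAverage μ a ^ 3
      = ∫⁻ a, ENNReal.ofReal ((maximalAverage μ a).toReal ^ (3 : ℝ)) := by
    refine lintegral_congr_ae ?_
    filter_upwards [maximalAverage_lt_top_ae μ] with a ha
    rw [show (3 : ℝ) = ((3 : ℕ) : ℝ) by norm_num, Real.rpow_natCast,
      ENNReal.ofReal_pow ENNReal.toReal_nonneg, ENNReal.ofReal_toReal ha.ne]
  have e2 : ∫⁻ a, ENNReal.ofReal ((2 * g a) ^ (2 : ℝ)) ∂μ
      = 4 * ∫⁻ a, ENNReal.ofReal (g a ^ 2) ∂μ := by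
    rw [← lintegral_const_mul _ (by fun_prop)]
    refine lintegral_congr fun a => ?_
    rw [show (2 : ℝ) = ((2 : ℕ) : ℝ) by norm_num, Real.rpow_natCast, mul_pow,
      ENNReal.ofReal_mul (by positivity)]
    norm_num
  rw [lintegral_rpow_eq_lintegral_meas_lt_mul μ
    (Eventually.of_forall fun a => by have := hg0 a; positivity) (by fun_prop) (by norm_num)] at e2
  rw [e1, lintegral_rpow_eq_lintegral_meas_lt_mul volume
    (Eventually.of_forall fun a => ENNReal.toReal_nonneg) hM.ennreal_toReal.aemeasurable
    (by norm_num)]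
  have hle : ∫⁻ t in Set.Ioi (0 : ℝ), volume {a | t < (maximalAverage μ a).toReal} *
        ENNReal.ofReal (t ^ ((3 : ℝ) - 1)) ≤
      ∫⁻ t in Set.Ioi (0 : ℝ), 8 * (μ {a | t < 2 * g a} * ENNReal.ofReal (t ^ ((2 : ℝ) - 1))) := by
    refine setLIntegral_mono' measurableSet_Ioi fun t ht => ?_
    have ht0 : (0 : ℝ) < t := ht
    have hw := mul_volume_two_mul_lt_maximalAverage_le hg μ hμ (half_pos ht0)
    have hset : {a | t / 2 < g a} = {a | t < 2 * g a} := by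
      ext a
      exact ⟨fun h => by have : t / 2 < g a := h; show t < 2 * g a; linarith,
        fun h => by have : t < 2 * g a := h; show t / 2 < g a; linarith⟩
    rw [hset] at hw
    have hsub : volume {a | t < (maximalAverage μ a).toReal} ≤
        volume {a | ENNReal.ofReal (2 * (t / 2)) < maximalAverage μ a} := by
      refine measure_mono fun a ha => ?_
      show ENNReal.ofReal (2 * (t / 2)) < maximalAverage μ a
      rw [mul_div_cancel₀ t two_ne_zero]
      have ha' : t < (maximalAverage μ a).toReal := ha
      refine (ENNReal.ofReal_lt_iff_lt_toReal ht0.le fun htop => ?_).2 ha'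
      rw [htop, ENNReal.toReal_top] at ha'
      exact lt_asymm ha' ht0
    have hp1 : t ^ ((3 : ℝ) - 1) = t / 2 * (2 * t) := by
      rw [show (3 : ℝ) - 1 = ((2 : ℕ) : ℝ) by norm_num, Real.rpow_natCast]
      ring
    have hp2 : t ^ ((2 : ℝ) - 1) = t := by
      rw [show (2 : ℝ) - 1 = 1 by norm_num, Real.rpow_one]
    rw [hp1, hp2, ENNReal.ofReal_mul (by positivity)]
    calc _ ≤ volume {a | ENNReal.ofReal (2 * (t / 2)) < maximalAverage μ a} *
          (ENNReal.ofReal (t / 2) * ENNReal.ofReal (2 * t)) := by gcongr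
      _ = (ENNReal.ofReal (t / 2) * volume {a | ENNReal.ofReal (2 * (t / 2)) < maximalAverage μ a})
          * ENNReal.ofReal (2 * t) := by ring
      _ ≤ 4 * μ {a | t < 2 * g a} * ENNReal.ofReal (2 * t) := by gcongr
      _ = _ := by
        rw [ENNReal.ofReal_mul (by norm_num), show (8 : ENNReal) = 4 * ENNReal.ofReal 2 by
          norm_num]
        ring
  calc _ ≤ ENNReal.ofReal 3 * ∫⁻ t in Set.Ioi (0 : ℝ),
        8 * (μ {a | t < 2 * g a} * ENNReal.ofReal (t ^ ((2 : ℝ) - 1))) := by gcongr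
    _ = 12 * (ENNReal.ofReal 2 * ∫⁻ t in Set.Ioi (0 : ℝ),
        μ {a | t < 2 * g a} * ENNReal.ofReal (t ^ ((2 : ℝ) - 1))) := by
      rw [lintegral_const_mul' _ _ (by norm_num), ← mul_assoc, ← mul_assoc]
      norm_num
    _ = _ := by
      rw [e2, ← mul_assoc]
      norm_num

theorem lintegral_maximalAverage_sq_lt_top {g : ℝ → ℝ} (hg : Measurable g) (hg0 : ∀ a, 0 ≤ g a)
    (μ : Measure ℝ) [IsFiniteMeasure μ]
    (hμ : μ = volume.withDensity fun a => ENNReal.ofReal (g a))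
    (hfin : ∫⁻ a, ENNReal.ofReal (g a ^ 2) ∂μ < ⊤) :
    ∫⁻ a, maximalAverage μ a ^ 2 ∂μ < ⊤ := by
  have hM := measurable_maximalAverage μ
  have hgm : Measurable fun a => ENNReal.ofReal (g a) := hg.ennreal_ofReal
  have e : ∀ h : ℝ → ENNReal, Measurable h →
      ∫⁻ a, h a ∂μ = ∫⁻ a, ENNReal.ofReal (g a) * h a := fun h hh => by
    conv_lhs => rw [hμ]
    rw [lintegral_withDensity_eq_lintegral_mul _ hgm hh]
    rfl
  have h3 : ∫⁻ a, ENNReal.ofReal (g a) ^ 3 < ⊤ := by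
    rw [e _ (by fun_prop)] at hfin
    convert hfin using 3 with a
    rw [ENNReal.ofReal_pow (hg0 a)]
    ring
  rw [e _ (by fun_prop)]
  calc ∫⁻ a, ENNReal.ofReal (g a) * maximalAverage μ a ^ 2
      ≤ ∫⁻ a, (ENNReal.ofReal (g a) ^ 3 + maximalAverage μ a ^ 3) := by
        refine lintegral_mono fun a => ?_
        rcases le_total (ENNReal.ofReal (g a)) (maximalAverage μ a) with h | h
        · calc _ ≤ maximalAverage μ a * maximalAverage μ a ^ 2 := by gcongr
            _ = maximalAverage μ a ^ 3 := by ring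
            _ ≤ _ := le_add_self
        · calc _ ≤ ENNReal.ofReal (g a) * ENNReal.ofReal (g a) ^ 2 := by gcongr
            _ = ENNReal.ofReal (g a) ^ 3 := by ring
            _ ≤ _ := le_self_add
    _ = (∫⁻ a, ENNReal.ofReal (g a) ^ 3) + ∫⁻ a, maximalAverage μ a ^ 3 :=
        lintegral_add_left (hgm.pow_const 3) _
    _ < ⊤ := ENNReal.add_lt_top.2 ⟨h3, (lintegral_maximalAverage_pow_three_le hg hg0 μ hμ).trans_lt
        (ENNReal.mul_lt_top (by norm_num) hfin)⟩

theorem lintegral_pow_four_le_of_tail {Y : Type*} [MeasurableSpace Y] (ν : Measure Y)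
    [IsProbabilityMeasure ν] {W : Y → ℝ} (hW : Measurable W) (hW0 : ∀ y, 0 ≤ W y) {K : ℝ}
    (hK : 0 < K) (htail : ∀ t, 0 < t → ν {y | t ≤ W y} ≤ ENNReal.ofReal ((K / t) ^ 5)) :
    ∫⁻ y, ENNReal.ofReal (W y ^ 4) ∂ν ≤ ENNReal.ofReal (8 * K ^ 4) := by
  have e : ∫⁻ y, ENNReal.ofReal (W y ^ 4) ∂ν = ∫⁻ y, ENNReal.ofReal (W y ^ (4 : ℝ)) ∂ν := by
    refine lintegral_congr fun y => ?_
    rw [show (4 : ℝ) = ((4 : ℕ) : ℝ) by norm_num, Real.rpow_natCast]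
  rw [e, lintegral_rpow_eq_lintegral_meas_le_mul ν (Eventually.of_forall hW0) hW.aemeasurable
    (by norm_num)]
  have hpow : ∀ t : ℝ, t ^ ((4 : ℝ) - 1) = t ^ 3 := fun t => by
    rw [show (4 : ℝ) - 1 = ((3 : ℕ) : ℝ) by norm_num, Real.rpow_natCast]
  simp only [hpow]
  rw [← Set.Ioc_union_Ioi_eq_Ioi hK.le]
  have h1 : ∫⁻ t in Set.Ioc 0 K, ν {y | t ≤ W y} * ENNReal.ofReal (t ^ 3) ≤
      ENNReal.ofReal (K ^ 4) := by
    calc _ ≤ ∫⁻ _ in Set.Ioc 0 K, ENNReal.ofReal (K ^ 3) := by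
          refine setLIntegral_mono' measurableSet_Ioc fun t ht => ?_
          calc _ ≤ 1 * ENNReal.ofReal (K ^ 3) := by
                have := ht.1.le
                have := ht.2
                gcongr
                exact prob_le_one
            _ = _ := one_mul _
      _ = _ := by
          rw [setLIntegral_const, Real.volume_Ioc, ← ENNReal.ofReal_mul (by positivity)]
          ring_nf
  have h2 : ∫⁻ t in Set.Ioi K, ν {y | t ≤ W y} * ENNReal.ofReal (t ^ 3) ≤
      ENNReal.ofReal (K ^ 4) := by
    have hint : IntegrableOn (fun t : ℝ => K ^ 5 * t ^ (-2 : ℝ)) (Set.Ioi K) :=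
      (integrableOn_Ioi_rpow_of_lt (by norm_num) hK).const_mul _
    calc _ ≤ ∫⁻ t in Set.Ioi K, ENNReal.ofReal (K ^ 5 * t ^ (-2 : ℝ)) := by
          refine setLIntegral_mono' measurableSet_Ioi fun t ht => ?_
          have ht0 : 0 < t := hK.trans ht
          calc _ ≤ ENNReal.ofReal ((K / t) ^ 5) * ENNReal.ofReal (t ^ 3) := by
                gcongr
                exact htail t ht0
            _ = _ := by
                rw [← ENNReal.ofReal_mul (by positivity), Real.rpow_neg ht0.le,
                  show (2 : ℝ) = ((2 : ℕ) : ℝ) by norm_num, Real.rpow_natCast]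
                congr 1
                field_simp
      _ = ENNReal.ofReal (∫ t in Set.Ioi K, K ^ 5 * t ^ (-2 : ℝ)) := by
          rw [ofReal_integral_eq_lintegral_ofReal hint]
          filter_upwards [ae_restrict_mem measurableSet_Ioi] with t ht
          have ht0 : 0 < t := hK.trans ht
          positivity
      _ = _ := by
          rw [integral_const_mul, integral_Ioi_rpow_of_lt (by norm_num) hK,
            show (-2 : ℝ) + 1 = -1 by norm_num, Real.rpow_neg_one]
          congr 1
          field_simp
  calc _ ≤ ENNReal.ofReal 4 * (ENNReal.ofReal (K ^ 4) + ENNReal.ofReal (K ^ 4)) := by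
        gcongr
        exact (lintegral_union_le _ _ _).trans (add_le_add h1 h2)
    _ = _ := by
        rw [← ENNReal.ofReal_add (by positivity) (by positivity),
          ← ENNReal.ofReal_mul (by norm_num)]
        ring_nf

/-- The spacing quotient at the `j`-th point of the sample which has `a` in place `j` and the
points `y` elsewhere. -/
noncomputable def insertedQuotient (N m : ℕ) (j : Fin (N + 1)) (a : ℝ) (y : Fin N → ℝ) : ℝ :=
  pointQuotient (N + 1) m (j.insertNth (α := fun _ => ℝ) a y) j

theorem measurable_insertedQuotient (N m : ℕ) (j : Fin (N + 1)) :
    Measurable fun q : ℝ × (Fin N → ℝ) => insertedQuotient N m j q.1 q.2 :=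
  (measurable_pointQuotient (N + 1) m j).comp
    (MeasurableEquiv.piFinSuccAbove (fun _ : Fin (N + 1) => ℝ) j).symm.measurable

theorem measurable_insertedQuotient_right (N m : ℕ) (j : Fin (N + 1)) (a : ℝ) :
    Measurable (insertedQuotient N m j a) :=
  Measurable.of_uncurry_left (f := insertedQuotient N m j) (measurable_insertedQuotient N m j)

theorem insertedQuotient_tail (μ : Measure ℝ) [IsProbabilityMeasure μ] {N m : ℕ} (hm : 5 ≤ m)
    (h2 : 2 * m < N + 1) (j : Fin (N + 1)) {a : ℝ} (hM : maximalAverage μ a < ⊤) {t : ℝ}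
    (ht : 0 < t) :
    Measure.pi (fun _ : Fin N => μ) {y | t ≤ insertedQuotient N m j a y} ≤
      ENNReal.ofReal (((12 * (maximalAverage μ a).toReal + 1) / t) ^ 5) := by
  set M := (maximalAverage μ a).toReal with hMdef
  have hM0 : 0 ≤ M := ENNReal.toReal_nonneg
  have hm0 : (0 : ℝ) < m := by
    have : 0 < m := by omega
    exact_mod_cast this
  set r : ℝ := 2 * m / ((N + 1 : ℕ) * t) with hr
  have hr0 : 0 < r := by positivity
  have hsub : {y : Fin N → ℝ | t ≤ insertedQuotient N m j a y} ⊆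
      {y | m ≤ hitCount (Set.Icc (a - r) (a + r)) y} := by
    intro y hy
    have := le_hitCount_of_le_pointQuotient (by omega) h2 _ j ht hy
    simp only [Fin.insertNth_apply_same, Fin.removeNth_insertNth] at this
    exact this
  have hA : μ (Set.Icc (a - r) (a + r)) ≤ ENNReal.ofReal (M * (2 * r)) := by
    rw [← Real.closedBall_eq_Icc, ENNReal.ofReal_mul hM0, hMdef, ENNReal.ofReal_toReal hM.ne]
    exact measure_closedBall_le_maximalAverage μ a hr0
  refine (measure_mono hsub).trans ((pi_le_hitCount_le_pow_five μ hm _ (by positivity) hA).trans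
    (ENNReal.ofReal_le_ofReal ?_))
  have hN : (0 : ℝ) < (N + 1 : ℕ) := by positivity
  have e : 3 * N * (M * (2 * r)) / m = 12 * M / t * (N / (N + 1 : ℕ)) := by
    rw [hr]
    field_simp
    ring
  have h1 : (N : ℝ) / (N + 1 : ℕ) ≤ 1 := by
    rw [div_le_one hN]
    push_cast
    linarith
  have h3 : 3 * N * (M * (2 * r)) / m ≤ (12 * M + 1) / t := by
    rw [e]
    calc 12 * M / t * (N / (N + 1 : ℕ)) ≤ 12 * M / t * 1 := by gcongr
      _ ≤ _ := by
        rw [mul_one]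
        gcongr
        linarith
  exact pow_le_pow_left₀ (by positivity) h3 5

theorem insertedQuotient_nonneg {N m : ℕ} (hm : 0 < m) (h2 : 2 * m < N + 1) (j : Fin (N + 1))
    (a : ℝ) (y : Fin N → ℝ) : 0 ≤ insertedQuotient N m j a y :=
  pointQuotient_nonneg hm h2 _ j

theorem lintegral_insertedQuotient_pow_four_le (μ : Measure ℝ) [IsProbabilityMeasure μ] {N m : ℕ}
    (hm : 5 ≤ m) (h2 : 2 * m < N + 1) (j : Fin (N + 1)) {a : ℝ} (hM : maximalAverage μ a < ⊤) :
    ∫⁻ y, ENNReal.ofReal (insertedQuotient N m j a y ^ 4) ∂Measure.pi (fun _ : Fin N => μ) ≤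
      ENNReal.ofReal (8 * (12 * (maximalAverage μ a).toReal + 1) ^ 4) :=
  lintegral_pow_four_le_of_tail _ (measurable_insertedQuotient_right N m j a)
    (insertedQuotient_nonneg (by omega) h2 j a)
    (by have := ENNReal.toReal_nonneg (a := maximalAverage μ a); positivity)
    fun _ ht => insertedQuotient_tail μ hm h2 j hM ht

theorem lintegral_insertedQuotient_sub_sq_le (μ : Measure ℝ) [IsProbabilityMeasure μ] {N m : ℕ}
    (hm : 5 ≤ m) (h2 : 2 * m < N + 1) (j : Fin (N + 1)) {a : ℝ} (hM : maximalAverage μ a < ⊤)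
    (c : ℝ) :
    ∫⁻ y, ENNReal.ofReal ((insertedQuotient N m j a y - c) ^ 2) ∂Measure.pi (fun _ : Fin N => μ) ≤
      ENNReal.ofReal (18 * (12 * (maximalAverage μ a).toReal + 1) ^ 2 + 2 * c ^ 2) := by
  set ν := Measure.pi fun _ : Fin N => μ
  set K := 12 * (maximalAverage μ a).toReal + 1 with hK
  have hK0 : 0 < K := by
    have := ENNReal.toReal_nonneg (a := maximalAverage μ a)
    positivity
  have hmeas := measurable_insertedQuotient_right N m j a
  have hpt : ∀ y, ENNReal.ofReal ((insertedQuotient N m j a y - c) ^ 2) ≤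
      ENNReal.ofReal (2 * K ^ 2 + 2 * c ^ 2) +
        ENNReal.ofReal (2 / K ^ 2) * ENNReal.ofReal (insertedQuotient N m j a y ^ 4) := by
    intro y
    set w := insertedQuotient N m j a y
    rw [← ENNReal.ofReal_mul (by positivity), ← ENNReal.ofReal_add (by positivity) (by positivity)]
    refine ENNReal.ofReal_le_ofReal ?_
    have h1 : w ^ 2 ≤ K ^ 2 + w ^ 4 / K ^ 2 := by
      rw [← sub_nonneg, show K ^ 2 + w ^ 4 / K ^ 2 - w ^ 2
        = ((K ^ 2 - w ^ 2) ^ 2 + w ^ 2 * K ^ 2) / K ^ 2 by field_simp; ring]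
      positivity
    have h3 : 2 / K ^ 2 * w ^ 4 = 2 * (w ^ 4 / K ^ 2) := by ring
    nlinarith [sq_nonneg (w + c)]
  calc _ ≤ ∫⁻ y, (ENNReal.ofReal (2 * K ^ 2 + 2 * c ^ 2) + ENNReal.ofReal (2 / K ^ 2) *
        ENNReal.ofReal (insertedQuotient N m j a y ^ 4)) ∂ν := lintegral_mono hpt
    _ = ENNReal.ofReal (2 * K ^ 2 + 2 * c ^ 2) + ENNReal.ofReal (2 / K ^ 2) *
        ∫⁻ y, ENNReal.ofReal (insertedQuotient N m j a y ^ 4) ∂ν := by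
      rw [lintegral_add_left measurable_const, lintegral_const_mul' _ _ ENNReal.ofReal_ne_top,
        lintegral_const, measure_univ, mul_one]
    _ ≤ ENNReal.ofReal (2 * K ^ 2 + 2 * c ^ 2) + ENNReal.ofReal (2 / K ^ 2) *
        ENNReal.ofReal (8 * K ^ 4) := by
      gcongr
      exact lintegral_insertedQuotient_pow_four_le μ hm h2 j hM
    _ = _ := by
      rw [← ENNReal.ofReal_mul (by positivity), ← ENNReal.ofReal_add (by positivity) (by positivity)]
      congr 1
      field_simp
      ring

theorem tendsto_pi_abs_hitCount_sub (μ : Measure ℝ) [IsProbabilityMeasure μ] {A : ℕ → Set ℝ}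
    (hA : ∀ N, MeasurableSet (A N)) {k : ℕ → ℕ} (hk : Tendsto k atTop atTop) {κ : ℝ}
    (h : Tendsto (fun N : ℕ => N * μ.real (A N) / k N) atTop (𝓝 κ)) {δ : ℝ} (hδ : 0 < δ) :
    Tendsto (fun N : ℕ => Measure.pi (fun _ : Fin N => μ)
      {y | δ * k N ≤ |(hitCount (A N) y : ℝ) - N * μ.real (A N)|}) atTop (𝓝 0) := by
  have hkr : Tendsto (fun N => (k N : ℝ)) atTop atTop := tendsto_natCast_atTop_atTop.comp hk
  have hlim : Tendsto (fun N : ℕ => ENNReal.ofReal (N * μ.real (A N) / k N / δ ^ 2 * (k N : ℝ)⁻¹))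
      atTop (𝓝 0) := by
    have := ENNReal.tendsto_ofReal ((h.div_const (δ ^ 2)).mul hkr.inv_tendsto_atTop)
    simpa using this
  refine tendsto_of_tendsto_of_tendsto_of_le_of_le' tendsto_const_nhds hlim
    (Eventually.of_forall fun _ => zero_le) ?_
  filter_upwards [hkr.eventually_gt_atTop 0] with N hN
  refine (pi_abs_hitCount_sub_le μ N (hA N) (by positivity)).trans_eq ?_
  congr 1
  field_simp

theorem tendsto_pi_hitCount_lt (μ : Measure ℝ) [IsProbabilityMeasure μ] {A : ℕ → Set ℝ}
    (hA : ∀ N, MeasurableSet (A N)) {k : ℕ → ℕ} (hk : Tendsto k atTop atTop) {κ : ℝ} (hκ : 1 < κ)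
    (h : Tendsto (fun N : ℕ => N * μ.real (A N) / k N) atTop (𝓝 κ)) :
    Tendsto (fun N : ℕ => Measure.pi (fun _ : Fin N => μ) {y | ¬ k N ≤ hitCount (A N) y})
      atTop (𝓝 0) := by
  have hkr : Tendsto (fun N => (k N : ℝ)) atTop atTop := tendsto_natCast_atTop_atTop.comp hk
  have hδ : 0 < (κ - 1) / 2 := by linarith
  refine tendsto_of_tendsto_of_tendsto_of_le_of_le' tendsto_const_nhds
    (tendsto_pi_abs_hitCount_sub μ hA hk h hδ) (Eventually.of_forall fun _ => zero_le) ?_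
  filter_upwards [hkr.eventually_gt_atTop 0,
    h.eventually (lt_mem_nhds (show (1 + κ) / 2 < κ by linarith))] with N hN hlt
  refine measure_mono fun y hy => ?_
  have hy' : (hitCount (A N) y : ℝ) < k N := by exact_mod_cast not_le.1 hy
  rw [lt_div_iff₀ hN] at hlt
  show (κ - 1) / 2 * k N ≤ |(hitCount (A N) y : ℝ) - N * μ.real (A N)|
  rw [abs_sub_comm]
  exact le_trans (by linarith) (le_abs_self _)

theorem tendsto_pi_le_hitCount (μ : Measure ℝ) [IsProbabilityMeasure μ] {A : ℕ → Set ℝ}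
    (hA : ∀ N, MeasurableSet (A N)) {k : ℕ → ℕ} (hk : Tendsto k atTop atTop) {κ : ℝ} (hκ : κ < 1)
    (h : Tendsto (fun N : ℕ => N * μ.real (A N) / k N) atTop (𝓝 κ)) :
    Tendsto (fun N : ℕ => Measure.pi (fun _ : Fin N => μ) {y | ¬ hitCount (A N) y < k N})
      atTop (𝓝 0) := by
  have hkr : Tendsto (fun N => (k N : ℝ)) atTop atTop := tendsto_natCast_atTop_atTop.comp hk
  have hδ : 0 < (1 - κ) / 2 := by linarith
  refine tendsto_of_tendsto_of_tendsto_of_le_of_le' tendsto_const_nhds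
    (tendsto_pi_abs_hitCount_sub μ hA hk h hδ) (Eventually.of_forall fun _ => zero_le) ?_
  filter_upwards [hkr.eventually_gt_atTop 0,
    h.eventually (gt_mem_nhds (show κ < (1 + κ) / 2 by linarith))] with N hN hlt
  refine measure_mono fun y hy => ?_
  have hy' : (k N : ℝ) ≤ hitCount (A N) y := by exact_mod_cast not_lt.1 hy
  rw [div_lt_iff₀ hN] at hlt
  show (1 - κ) / 2 * k N ≤ |(hitCount (A N) y : ℝ) - N * μ.real (A N)|
  exact le_trans (by linarith) (le_abs_self _)

theorem measureReal_Ioc_eq_cdf (μ : Measure ℝ) [IsProbabilityMeasure μ] {a b : ℝ} (hab : a ≤ b) :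
    μ.real (Set.Ioc a b) = cdf μ b - cdf μ a := by
  conv_lhs => rw [← measure_cdf μ]
  rw [measureReal_def, StieltjesFunction.measure_Ioc,
    ENNReal.toReal_ofReal (sub_nonneg.2 (monotone_cdf μ hab))]

theorem tendsto_mul_slope_div {k : ℕ → ℕ} (hk : Tendsto k atTop atTop)
    (hk0 : Tendsto (fun N : ℕ => (k N : ℝ) / (N + 1 : ℕ)) atTop (𝓝 0))
    {F : ℝ → ℝ} {a c : ℝ} (hF : HasDerivAt F c a) {s : ℝ} (hs : s ≠ 0) :
    Tendsto (fun N : ℕ => N * (F (a + (k N : ℝ) / (N + 1 : ℕ) * s) - F a) / k N) atTop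
      (𝓝 (c * s)) := by
  have hkr : Tendsto (fun N => (k N : ℝ)) atTop atTop := tendsto_natCast_atTop_atTop.comp hk
  have hb : Tendsto (fun N : ℕ => (k N : ℝ) / (N + 1 : ℕ) * s) atTop (𝓝[≠] 0) := by
    refine tendsto_nhdsWithin_iff.2 ⟨by simpa using hk0.mul_const s, ?_⟩
    filter_upwards [hkr.eventually_gt_atTop 0] with N hN
    have : (k N : ℝ) / (N + 1 : ℕ) * s ≠ 0 := by positivity
    exact this
  have hN : Tendsto (fun N : ℕ => (N : ℝ) / (N + 1 : ℕ)) atTop (𝓝 1) := by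
    simpa using tendsto_natCast_div_add_atTop (1 : ℝ)
  have h1 := (hN.mul ((hasDerivAt_iff_tendsto_slope_zero.1 hF).comp hb)).mul_const s
  rw [one_mul] at h1
  refine h1.congr' ?_
  filter_upwards [hkr.eventually_gt_atTop 0] with N hN
  simp only [Function.comp_apply, smul_eq_mul]
  field_simp

theorem tendsto_pi_insertedQuotient {k : ℕ → ℕ} (hk : Tendsto k atTop atTop)
    (hk0 : Tendsto (fun N : ℕ => (k N : ℝ) / (N + 1 : ℕ)) atTop (𝓝 0))
    (μ : Measure ℝ) [IsProbabilityMeasure μ] [NullSingletonClass μ] {a c ε : ℝ}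
    (hF : HasDerivAt (cdf μ) c a) (hε : 0 < ε) (hεc : ε < c) :
    ∃ B : ∀ N : ℕ, Set (Fin N → ℝ), (∀ N, MeasurableSet (B N)) ∧
      Tendsto (fun N : ℕ => Measure.pi (fun _ : Fin N => μ) (B N)) atTop (𝓝 0) ∧
      ∀ N, 0 < k N → 2 * k N < N + 1 → ∀ (j : Fin (N + 1)) (y : Fin N → ℝ), y ∉ B N →
        |insertedQuotient N (k N) j a y - c| ≤ ε := by
  have hkr : Tendsto (fun N => (k N : ℝ)) atTop atTop := tendsto_natCast_atTop_atTop.comp hk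
  have hc1 : 0 < c - ε := by linarith
  have hc0 : 0 < c + ε := by linarith
  set b : ℝ → ℕ → ℝ := fun s N => (k N : ℝ) / (N + 1 : ℕ) * s with hb
  have hb0 : ∀ s, 0 < s → ∀ N, 0 ≤ b s N := fun s hs N => by positivity
  have hR : ∀ s, 0 < s → Tendsto (fun N : ℕ => N * μ.real (Set.Ioc a (a + b s N)) / k N) atTop
      (𝓝 (c * s)) := fun s hs => by
    refine (tendsto_mul_slope_div hk hk0 hF hs.ne').congr fun N => ?_
    rw [measureReal_Ioc_eq_cdf μ (by linarith [hb0 s hs N])]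
  have hL : ∀ s, 0 < s → Tendsto (fun N : ℕ => N * μ.real (Set.Ioc (a - b s N) a) / k N) atTop
      (𝓝 (c * s)) := fun s hs => by
    have := (tendsto_mul_slope_div hk hk0 hF (neg_ne_zero.2 hs.ne')).neg
    rw [mul_neg, neg_neg] at this
    refine this.congr fun N => ?_
    rw [measureReal_Ioc_eq_cdf μ (by linarith [hb0 s hs N]), mul_neg, ← sub_eq_add_neg]
    ring
  have κ1 : 1 < c * (c - ε)⁻¹ := by
    rw [← div_eq_mul_inv, lt_div_iff₀ hc1]
    linarith
  have κ0 : c * (c + ε)⁻¹ < 1 := by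
    rw [← div_eq_mul_inv, div_lt_one hc0]
    linarith
  have i1 : 0 < (c - ε)⁻¹ := by positivity
  have i0 : 0 < (c + ε)⁻¹ := by positivity
  set b₁ := b (c - ε)⁻¹
  set b₀ := b (c + ε)⁻¹
  have t1 := tendsto_pi_hitCount_lt μ (A := fun N => Set.Ioc a (a + b₁ N))
    (fun _ => measurableSet_Ioc) hk κ1 (hR _ i1)
  have t2 := tendsto_pi_hitCount_lt μ (A := fun N => Set.Ico (a - b₁ N) a)
    (fun _ => measurableSet_Ico) hk κ1 ((hL _ i1).congr fun N => by
      rw [measureReal_congr Ico_ae_eq_Ioc])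
  have t3 := tendsto_pi_le_hitCount μ (A := fun N => Set.Icc a (a + b₀ N))
    (fun _ => measurableSet_Icc) hk κ0 ((hR _ i0).congr fun N => by
      rw [measureReal_congr Ioc_ae_eq_Icc])
  have t4 := tendsto_pi_le_hitCount μ (A := fun N => Set.Icc (a - b₀ N) a)
    (fun _ => measurableSet_Icc) hk κ0 ((hL _ i0).congr fun N => by
      rw [measureReal_congr Ioc_ae_eq_Icc])
  refine ⟨fun N => ({y | ¬ k N ≤ hitCount (Set.Ioc a (a + b₁ N)) y} ∪
      {y | ¬ k N ≤ hitCount (Set.Ico (a - b₁ N) a) y}) ∪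
      ({y | ¬ hitCount (Set.Icc a (a + b₀ N)) y < k N} ∪
      {y | ¬ hitCount (Set.Icc (a - b₀ N) a) y < k N}), fun N => ?_, ?_, ?_⟩
  · refine MeasurableSet.union (MeasurableSet.union ?_ ?_) (MeasurableSet.union ?_ ?_)
    · exact (measurableSet_le measurable_const (measurable_hitCount measurableSet_Ioc)).compl
    · exact (measurableSet_le measurable_const (measurable_hitCount measurableSet_Ico)).compl
    · exact (measurableSet_lt (measurable_hitCount measurableSet_Icc) measurable_const).compl
    · exact (measurableSet_lt (measurable_hitCount measurableSet_Icc) measurable_const).compl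
  · have := (t1.add t2).add (t3.add t4)
    simp only [add_zero] at this
    exact tendsto_of_tendsto_of_tendsto_of_le_of_le tendsto_const_nhds this
      (fun _ => zero_le) fun N => (measure_union_le _ _).trans
        (add_le_add (measure_union_le _ _) (measure_union_le _ _))
  · intro N hkN h2 j y hy
    have hkN' : (0 : ℝ) < k N := by exact_mod_cast hkN
    rw [Set.mem_union, Set.mem_union, Set.mem_union, not_or, not_or, not_or] at hy
    obtain ⟨⟨h1, h2'⟩, h3, h4⟩ := hy
    have hpos : 0 < b₀ N := by
      have : 0 < (k N : ℝ) / (N + 1 : ℕ) * (c + ε)⁻¹ := by positivity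
      exact this
    have := pointQuotient_mem_Icc hkN h2 (j.insertNth (α := fun _ => ℝ) a y) j (b₀ := b₀ N)
      (b₁ := b₁ N) hpos
      (by simpa only [Fin.insertNth_apply_same, Fin.removeNth_insertNth] using not_not.1 h1)
      (by simpa only [Fin.insertNth_apply_same, Fin.removeNth_insertNth] using not_not.1 h2')
      (by simpa only [Fin.insertNth_apply_same, Fin.removeNth_insertNth] using not_not.1 h3)
      (by simpa only [Fin.insertNth_apply_same, Fin.removeNth_insertNth] using not_not.1 h4)
    have e1 : (k N : ℝ) / (N + 1 : ℕ) / b₁ N = c - ε := by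
      show (k N : ℝ) / (N + 1 : ℕ) / ((k N : ℝ) / (N + 1 : ℕ) * (c - ε)⁻¹) = c - ε
      field_simp
    have e0 : (k N : ℝ) / (N + 1 : ℕ) / b₀ N = c + ε := by
      show (k N : ℝ) / (N + 1 : ℕ) / ((k N : ℝ) / (N + 1 : ℕ) * (c + ε)⁻¹) = c + ε
      field_simp
    rw [e1, e0] at this
    rw [abs_le]
    have h5 : c - ε ≤ insertedQuotient N (k N) j a y := this.1
    have h6 : insertedQuotient N (k N) j a y ≤ c + ε := this.2
    constructor <;> linarith

theorem tendsto_iSup_lintegral_insertedQuotient {k : ℕ → ℕ} (hk : Tendsto k atTop atTop)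
    (hk0 : Tendsto (fun N : ℕ => (k N : ℝ) / (N + 1 : ℕ)) atTop (𝓝 0))
    (μ : Measure ℝ) [IsProbabilityMeasure μ] [NullSingletonClass μ]
    {a c : ℝ} (hF : HasDerivAt (cdf μ) c a) (hc : 0 < c) (hM : maximalAverage μ a < ⊤) :
    Tendsto (fun N : ℕ => ⨆ j, ∫⁻ y, ENNReal.ofReal ((insertedQuotient N (k N) j a y - c) ^ 2)
      ∂Measure.pi (fun _ : Fin N => μ)) atTop (𝓝 0) := by
  set K := 12 * (maximalAverage μ a).toReal + 1 with hK
  set C := 8 * (8 * K ^ 4 + c ^ 4) with hC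
  have hC0 : 0 ≤ C := by positivity
  rw [ENNReal.tendsto_nhds_zero]
  intro δ hδ
  have hδ2 : 0 < δ / 2 := ENNReal.half_pos hδ.ne'
  have hlim : Tendsto (fun ε : ℝ => ENNReal.ofReal (ε ^ 2 + ε * C)) (𝓝[>] 0) (𝓝 0) := by
    have : Tendsto (fun ε : ℝ => ENNReal.ofReal (ε ^ 2 + ε * C)) (𝓝 0)
        (𝓝 (ENNReal.ofReal (0 ^ 2 + 0 * C))) :=
      (ENNReal.continuous_ofReal.comp (by fun_prop)).tendsto 0
    simp only [ne_eq, OfNat.ofNat_ne_zero, not_false_eq_true, zero_pow, zero_mul, add_zero,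
      ENNReal.ofReal_zero] at this
    exact this.mono_left nhdsWithin_le_nhds
  obtain ⟨ε, hε1, hε2⟩ := ((hlim.eventually (gt_mem_nhds hδ2)).and
    (Ioo_mem_nhdsGT hc)).exists
  obtain ⟨B, hBm, hB0, hB⟩ := tendsto_pi_insertedQuotient hk hk0 μ hF hε2.1 hε2.2
  have hBlim : Tendsto (fun N : ℕ => ENNReal.ofReal ε⁻¹ * Measure.pi (fun _ : Fin N => μ) (B N)) atTop
      (𝓝 0) := by
    simpa using ENNReal.Tendsto.const_mul hB0 (Or.inr (ENNReal.ofReal_ne_top (r := ε⁻¹)))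
  have hsmall : ∀ᶠ N : ℕ in atTop, 2 * k N < N + 1 := by
    filter_upwards [hk0.eventually (gt_mem_nhds (show (0 : ℝ) < 1 / 2 by norm_num))] with N hN
    rw [div_lt_div_iff₀ (by positivity) (by norm_num)] at hN
    have : ((2 * k N : ℕ) : ℝ) < (N + 1 : ℕ) := by push_cast at hN ⊢; linarith
    exact_mod_cast this
  filter_upwards [hBlim.eventually (gt_mem_nhds hδ2), hsmall, hk.eventually_ge_atTop 5]
    with N hN h2 h5
  refine iSup_le fun j => ?_
  set ν := Measure.pi fun _ : Fin N => μ
  have hε0 : 0 < ε := hε2.1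
  have hpt : ∀ y, ENNReal.ofReal ((insertedQuotient N (k N) j a y - c) ^ 2) ≤
      ENNReal.ofReal (ε ^ 2 + ε * (8 * c ^ 4)) + ((B N).indicator (fun _ => ENNReal.ofReal ε⁻¹) y +
        ENNReal.ofReal (ε * 8) * ENNReal.ofReal (insertedQuotient N (k N) j a y ^ 4)) := by
    intro y
    set w := insertedQuotient N (k N) j a y with hw
    have hz4 : (w - c) ^ 4 ≤ 8 * (w ^ 4 + c ^ 4) := by
      nlinarith [sq_nonneg (w ^ 2 - c ^ 2), sq_nonneg (w + c), sq_nonneg ((w + c) ^ 2),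
        mul_nonneg (sq_nonneg (w + c)) (sq_nonneg (w - c)), sq_nonneg (w * (w + c)),
        sq_nonneg (c * (w + c)), sq_nonneg ((w - c) ^ 2 - (w + c) ^ 2)]
    have hw4 : 0 ≤ w ^ 4 := by positivity
    by_cases hy : y ∈ B N
    · rw [Set.indicator_of_mem hy, ← ENNReal.ofReal_mul (by positivity),
        ← ENNReal.ofReal_add (by positivity) (by positivity),
        ← ENNReal.ofReal_add (by positivity) (by positivity)]
      refine ENNReal.ofReal_le_ofReal ?_
      have h1 : (w - c) ^ 2 ≤ ε⁻¹ + ε * (w - c) ^ 4 := by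
        have e : ε⁻¹ + ε * (w - c) ^ 4 - (w - c) ^ 2 =
            ε⁻¹ * ((1 - ε * (w - c) ^ 2) ^ 2 + ε * (w - c) ^ 2) := by
          field_simp
          ring
        have : 0 ≤ ε⁻¹ * ((1 - ε * (w - c) ^ 2) ^ 2 + ε * (w - c) ^ 2) := by positivity
        linarith
      nlinarith [sq_nonneg ε]
    · refine le_trans (ENNReal.ofReal_le_ofReal ?_) le_self_add
      have h1 := hB N (by omega) h2 j y hy
      have h3 : (w - c) ^ 2 ≤ ε ^ 2 := sq_le_sq' (by linarith [(abs_le.1 h1).1]) (abs_le.1 h1).2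
      have : 0 ≤ ε * (8 * c ^ 4) := by positivity
      linarith
  calc _ ≤ ∫⁻ y, (ENNReal.ofReal (ε ^ 2 + ε * (8 * c ^ 4)) +
        ((B N).indicator (fun _ => ENNReal.ofReal ε⁻¹) y + ENNReal.ofReal (ε * 8) *
          ENNReal.ofReal (insertedQuotient N (k N) j a y ^ 4))) ∂ν := lintegral_mono hpt
    _ = ENNReal.ofReal (ε ^ 2 + ε * (8 * c ^ 4)) + (ENNReal.ofReal ε⁻¹ * ν (B N) +
        ENNReal.ofReal (ε * 8) *
          ∫⁻ y, ENNReal.ofReal (insertedQuotient N (k N) j a y ^ 4) ∂ν) := by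
      rw [lintegral_add_left measurable_const,
        lintegral_add_left (measurable_const.indicator (hBm N)),
        lintegral_const_mul' _ _ ENNReal.ofReal_ne_top, lintegral_indicator_const (hBm N),
        lintegral_const, measure_univ, mul_one]
    _ ≤ ENNReal.ofReal (ε ^ 2 + ε * (8 * c ^ 4)) + (ENNReal.ofReal ε⁻¹ * ν (B N) +
        ENNReal.ofReal (ε * 8) * ENNReal.ofReal (8 * K ^ 4)) := by
      gcongr
      exact lintegral_insertedQuotient_pow_four_le μ h5 h2 j hM
    _ = ENNReal.ofReal ε⁻¹ * ν (B N) + ENNReal.ofReal (ε ^ 2 + ε * C) := by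
      rw [add_left_comm, ← ENNReal.ofReal_mul (by positivity),
        ← ENNReal.ofReal_add (by positivity) (by positivity)]
      congr 2
      rw [hC]
      ring
    _ ≤ δ / 2 + δ / 2 := add_le_add hN.le hε1.le
    _ = δ := ENNReal.add_halves δ

theorem tendsto_lintegral_iSup_insertedQuotient {k : ℕ → ℕ} (hk : Tendsto k atTop atTop)
    (hk0 : Tendsto (fun N : ℕ => (k N : ℝ) / (N + 1 : ℕ)) atTop (𝓝 0))
    {g : ℝ → ℝ} (hg : Measurable g) (hg0 : ∀ a, 0 ≤ g a) (μ : Measure ℝ) [IsProbabilityMeasure μ]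
    (hμ : μ = volume.withDensity fun a => ENNReal.ofReal (g a))
    (hfin : ∫⁻ a, ENNReal.ofReal (g a ^ 2) ∂μ < ⊤) :
    Tendsto (fun N : ℕ => ∫⁻ a, ⨆ j, ∫⁻ y,
      ENNReal.ofReal ((insertedQuotient N (k N) j a y - g a) ^ 2)
        ∂Measure.pi (fun _ : Fin N => μ) ∂μ) atTop (𝓝 0) := by
  have hgm : Measurable fun a => ENNReal.ofReal (g a) := hg.ennreal_ofReal
  have hac : μ ≪ volume := hμ ▸ withDensity_absolutelyContinuous _ _
  have : NullSingletonClass μ := ⟨fun x => hac (measure_singleton x)⟩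
  have hderiv : ∀ᵐ a ∂μ, HasDerivAt (cdf μ) (g a) a := by
    have h1 := StieltjesFunction.ae_hasDerivAt (cdf μ)
    rw [measure_cdf] at h1
    have h2 : μ.rnDeriv volume =ᵐ[volume] fun a => ENNReal.ofReal (g a) := by
      conv_lhs => rw [hμ]
      exact Measure.rnDeriv_withDensity _ hgm
    refine hac.ae_le ?_
    filter_upwards [h1, h2] with a ha ha2
    rwa [ha2, ENNReal.toReal_ofReal (hg0 a)] at ha
  have hMfin : ∀ᵐ a ∂μ, maximalAverage μ a < ⊤ := hac.ae_le (maximalAverage_lt_top_ae μ)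
  have hpos : ∀ᵐ a ∂μ, 0 < g a := by
    have : ∀ᵐ a ∂(volume.withDensity fun a => ENNReal.ofReal (g a)), 0 < g a := by
      rw [ae_withDensity_iff hgm]
      refine Eventually.of_forall fun a ha => ?_
      simpa using ha
    rwa [← hμ] at this
  have hsmall : ∀ᶠ N : ℕ in atTop, 2 * k N < N + 1 := by
    filter_upwards [hk0.eventually (gt_mem_nhds (show (0 : ℝ) < 1 / 2 by norm_num))] with N hN
    rw [div_lt_div_iff₀ (by positivity) (by norm_num)] at hN
    have : ((2 * k N : ℕ) : ℝ) < (N + 1 : ℕ) := by push_cast at hN ⊢; linarith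
    exact_mod_cast this
  have hlim := tendsto_lintegral_filter_of_dominated_convergence (μ := μ) (l := atTop)
    (F := fun (N : ℕ) a => ⨆ j, ∫⁻ y,
      ENNReal.ofReal ((insertedQuotient N (k N) j a y - g a) ^ 2)
        ∂Measure.pi (fun _ : Fin N => μ)) (f := fun _ => 0)
    (fun a => ENNReal.ofReal
      (18 * (12 * (maximalAverage μ a).toReal + 1) ^ 2 + 2 * g a ^ 2)) ?_ ?_ ?_ ?_
  · simpa using hlim
  · refine Eventually.of_forall fun N => Measurable.iSup fun j => ?_
    refine Measurable.lintegral_prod_right' (f := fun q : ℝ × (Fin N → ℝ) =>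
      ENNReal.ofReal ((insertedQuotient N (k N) j q.1 q.2 - g q.1) ^ 2)) ?_
    exact (((measurable_insertedQuotient N (k N) j).sub
      (hg.comp measurable_fst)).pow_const 2).ennreal_ofReal
  · filter_upwards [hsmall, hk.eventually_ge_atTop 5] with N h2 h5
    filter_upwards [hMfin] with a ha
    exact iSup_le fun j => lintegral_insertedQuotient_sub_sq_le μ h5 h2 j ha (g a)
  · have hM2 := lintegral_maximalAverage_sq_lt_top hg hg0 μ hμ hfin
    have hle : ∀ᵐ a ∂μ, ENNReal.ofReal
        (18 * (12 * (maximalAverage μ a).toReal + 1) ^ 2 + 2 * g a ^ 2) ≤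
        ENNReal.ofReal 5184 * maximalAverage μ a ^ 2 + (ENNReal.ofReal 36 +
          ENNReal.ofReal 2 * ENNReal.ofReal (g a ^ 2)) := by
      filter_upwards [hMfin] with a ha
      have e : maximalAverage μ a ^ 2 = ENNReal.ofReal ((maximalAverage μ a).toReal ^ 2) := by
        rw [ENNReal.ofReal_pow ENNReal.toReal_nonneg, ENNReal.ofReal_toReal ha.ne]
      rw [e, ← ENNReal.ofReal_mul (by norm_num), ← ENNReal.ofReal_mul (by norm_num),
        ← ENNReal.ofReal_add (by norm_num) (by positivity),
        ← ENNReal.ofReal_add (by positivity) (by positivity)]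
      refine ENNReal.ofReal_le_ofReal ?_
      nlinarith [sq_nonneg (12 * (maximalAverage μ a).toReal - 1)]
    refine ((lintegral_mono_ae hle).trans_lt ?_).ne
    rw [lintegral_add_left ((measurable_maximalAverage μ).pow_const 2 |>.const_mul _),
      lintegral_add_left measurable_const, lintegral_const_mul' _ _ ENNReal.ofReal_ne_top,
      lintegral_const_mul' _ _ ENNReal.ofReal_ne_top, lintegral_const, measure_univ, mul_one]
    exact ENNReal.add_lt_top.2 ⟨ENNReal.mul_lt_top ENNReal.ofReal_lt_top hM2,
      ENNReal.add_lt_top.2 ⟨ENNReal.ofReal_lt_top, ENNReal.mul_lt_top ENNReal.ofReal_lt_top hfin⟩⟩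
  · filter_upwards [hderiv, hMfin, hpos] with a h1 h2 h3
    exact tendsto_iSup_lintegral_insertedQuotient hk hk0 μ h1 h3 h2

theorem lintegral_pointQuotient_sub_sq_le {g : ℝ → ℝ} (hg : Measurable g) (μ : Measure ℝ)
    [IsProbabilityMeasure μ] (N m : ℕ) (j : Fin (N + 1)) :
    ∫⁻ x, ENNReal.ofReal ((pointQuotient (N + 1) m x j - g (x j)) ^ 2)
        ∂Measure.pi (fun _ : Fin (N + 1) => μ) ≤
      ∫⁻ a, ⨆ j, ∫⁻ y, ENNReal.ofReal ((insertedQuotient N m j a y - g a) ^ 2)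
        ∂Measure.pi (fun _ : Fin N => μ) ∂μ := by
  have hmeas : Measurable fun x : Fin (N + 1) → ℝ =>
      ENNReal.ofReal ((pointQuotient (N + 1) m x j - g (x j)) ^ 2) :=
    (((measurable_pointQuotient (N + 1) m j).sub
      (hg.comp (measurable_pi_apply j))).pow_const 2).ennreal_ofReal
  have hmp := (measurePreserving_piFinSuccAbove (fun _ : Fin (N + 1) => μ) j).symm
  have hc := (hmeas.comp hmp.measurable).aemeasurable (μ := μ.prod (Measure.pi fun _ : Fin N => μ))
  simp only [Function.comp_def] at hc
  rw [← hmp.lintegral_comp hmeas, lintegral_prod _ hc]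
  refine lintegral_mono fun a => le_iSup_of_le j (le_of_eq ?_)
  refine lintegral_congr fun y => ?_
  have e : (MeasurableEquiv.piFinSuccAbove (fun _ : Fin (N + 1) => ℝ) j).symm (a, y)
      = j.insertNth (α := fun _ => ℝ) a y := rfl
  rw [e, Fin.insertNth_apply_same]
  rfl

/-- If the mean square of `W - u` tends to zero and the first two empirical moments of `u`
converge, then the empirical variances of `W` converge. -/
theorem tendsto_empirical_variance {n : ℕ → ℕ} {W u : ∀ i, Fin (n i) → ℝ} {E₁ E₂ : ℝ}
    (hA : Tendsto (fun i => 1 / (n i : ℝ) * ∑ j, (W i j - u i j) ^ 2) atTop (𝓝 0))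
    (h₁ : Tendsto (fun i => (∑ j, u i j) / (n i : ℝ)) atTop (𝓝 E₁))
    (h₂ : Tendsto (fun i => (∑ j, u i j ^ 2) / (n i : ℝ)) atTop (𝓝 E₂)) :
    Tendsto (fun i => 1 / (4 * (n i : ℝ)) * ∑ j, W i j ^ 2 - 1 / 4 * (1 / (n i : ℝ) * ∑ j, W i j) ^ 2)
      atTop (𝓝 (1 / 4 * (E₂ - E₁ ^ 2))) := by
  have hcross : ∀ v : ∀ i, Fin (n i) → ℝ, ∀ E : ℝ,
      Tendsto (fun i => (∑ j, v i j ^ 2) / (n i : ℝ)) atTop (𝓝 E) →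
      Tendsto (fun i => 1 / (n i : ℝ) * ∑ j, v i j * (W i j - u i j)) atTop (𝓝 0) := by
    intro v E hv
    have hb : Tendsto (fun i => √((∑ j, v i j ^ 2) / (n i : ℝ) *
        (1 / (n i : ℝ) * ∑ j, (W i j - u i j) ^ 2))) atTop (𝓝 0) := by
      simpa using (hv.mul hA).sqrt
    refine squeeze_zero_norm (fun i => ?_) hb
    rw [Real.norm_eq_abs]
    refine Real.abs_le_sqrt ?_
    have hcs := Finset.sum_mul_sq_le_sq_mul_sq Finset.univ (v i) (fun j => W i j - u i j)
    calc (1 / (n i : ℝ) * ∑ j, v i j * (W i j - u i j)) ^ 2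
        = (1 / (n i : ℝ)) ^ 2 * (∑ j, v i j * (W i j - u i j)) ^ 2 := by ring
      _ ≤ (1 / (n i : ℝ)) ^ 2 * ((∑ j, v i j ^ 2) * ∑ j, (W i j - u i j) ^ 2) := by gcongr
      _ = _ := by ring
  have hu := hcross u E₂ h₂
  have hone : Tendsto (fun i => 1 / (n i : ℝ) * ∑ j, (W i j - u i j)) atTop (𝓝 0) := by
    have hb : Tendsto (fun i => √(1 / (n i : ℝ) * ∑ j, (W i j - u i j) ^ 2)) atTop (𝓝 0) := by
      simpa using hA.sqrt
    refine squeeze_zero_norm (fun i => ?_) hb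
    rw [Real.norm_eq_abs]
    refine Real.abs_le_sqrt ?_
    rcases Nat.eq_zero_or_pos (n i) with h0 | h0
    · simp [h0]
    · have hcs := sq_sum_le_card_mul_sum_sq (s := Finset.univ) (f := fun j => W i j - u i j)
      rw [Finset.card_univ, Fintype.card_fin] at hcs
      have h0' : (0 : ℝ) < n i := by exact_mod_cast h0
      calc (1 / (n i : ℝ) * ∑ j, (W i j - u i j)) ^ 2
          = (1 / (n i : ℝ)) ^ 2 * (∑ j, (W i j - u i j)) ^ 2 := by ring
        _ ≤ (1 / (n i : ℝ)) ^ 2 * (n i * ∑ j, (W i j - u i j) ^ 2) := by gcongr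
        _ = _ := by field_simp
  have h1 := h₁.add hone
  have h2 := (h₂.add (hu.const_mul 2)).add hA
  have h := (h2.sub (h1.pow 2)).const_mul (1 / 4)
  simp only [mul_zero, add_zero] at h
  refine h.congr fun i => ?_
  have e1 : (∑ j, u i j) / (n i : ℝ) + 1 / (n i : ℝ) * ∑ j, (W i j - u i j)
      = 1 / (n i : ℝ) * ∑ j, W i j := by
    rw [Finset.sum_sub_distrib]
    ring
  have e2 : (∑ j, u i j ^ 2) / (n i : ℝ) + 2 * (1 / (n i : ℝ) * ∑ j, u i j * (W i j - u i j))
      + 1 / (n i : ℝ) * ∑ j, (W i j - u i j) ^ 2 = 1 / (n i : ℝ) * ∑ j, W i j ^ 2 := by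
    have : ∑ j, W i j ^ 2 = ∑ j, u i j ^ 2 + 2 * ∑ j, u i j * (W i j - u i j)
        + ∑ j, (W i j - u i j) ^ 2 := by
      rw [Finset.mul_sum, ← Finset.sum_add_distrib, ← Finset.sum_add_distrib]
      exact Finset.sum_congr rfl fun j _ => by ring
    rw [this]
    ring
  rw [e1, e2]
  ring

theorem mainTheorem3 {Ω : Type*} [MeasurableSpace Ω] (P : Measure Ω) [IsProbabilityMeasure P]
    (X : ℕ → Ω → ℝ)
    (hpdf : ∀ i, HasPDF (X i) P volume)
    (hindep : iIndepFun X P)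
    (hident : ∀ i, IdentDistrib (X i) (X 0) P P)
    (hfin : MemLp (fun ω => (pdf (X 0) P volume (X 0 ω)).toReal) 2 P)
    (m : ℕ → ℕ)
    (hm : Tendsto m atTop atTop)
    (hmn : Tendsto (fun n : ℕ => (m n : ℝ) / (n : ℝ)) atTop (𝓝 0)) :
    TendstoInMeasure P
      (fun (n : ℕ) (ω : Ω) => spacingEstimator n (m n) (fun i : Fin n => X i ω))
      atTop (fun _ => varextropy (X 0) P) := by
  have := hpdf 0
  have hX : ∀ i, AEMeasurable (X i) P := fun i => (hident i).aemeasurable_fst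
  set g : ℝ → ℝ := fun a => (pdf (X 0) P volume a).toReal with hgdef
  have hg : Measurable g := (measurable_pdf (X 0) P volume).ennreal_toReal
  have hg0 : ∀ a, 0 ≤ g a := fun a => ENNReal.toReal_nonneg
  set μ := P.map (X 0) with hμdef
  have : IsProbabilityMeasure μ := Measure.isProbabilityMeasure_map (hX 0)
  have hμ : μ = volume.withDensity fun a => ENNReal.ofReal (g a) := by
    rw [hμdef, map_eq_withDensity_pdf (X 0) P volume]
    exact withDensity_congr_ae pdf.ofReal_toReal_ae_eq.symm
  have hL2 : MemLp (fun ω => g (X 0 ω)) 2 P := hfin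
  have hfin' : ∫⁻ a, ENNReal.ofReal (g a ^ 2) ∂μ < ⊤ := by
    rw [hμdef, lintegral_map' (by fun_prop) (hX 0)]
    exact hL2.integrable_sq.lintegral_lt_top
  set k : ℕ → ℕ := fun N => m (N + 1) with hkdef
  have hk : Tendsto k atTop atTop := (tendsto_add_atTop_iff_nat 1).2 hm
  have hk0 : Tendsto (fun N : ℕ => (k N : ℝ) / (N + 1 : ℕ)) atTop (𝓝 0) :=
    (tendsto_add_atTop_iff_nat (f := fun n : ℕ => (m n : ℝ) / (n : ℝ)) 1).2 hmn
  have hjoint : ∀ n, P.map (fun ω (i : Fin n) => X i ω) = Measure.pi fun _ => μ := by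
    intro n
    have hi : iIndepFun (fun (i : Fin n) => X i) P := hindep.precomp Fin.val_injective
    rw [iIndepFun.map_fun_eq_pi_map (f := fun (i : Fin n) => X i) (fun i => hX i) hi]
    congr 1
    funext i
    exact (hident i).map_eq
  have hXn : ∀ n, AEMeasurable (fun ω (i : Fin n) => X i ω) P := fun n =>
    aemeasurable_pi_lambda _ fun i => hX i
  set A : ℕ → Ω → ℝ := fun n ω => 1 / (n : ℝ) * ∑ j : Fin n,
    (pointQuotient n (m n) (fun i : Fin n => X i ω) j - g (X j ω)) ^ 2 with hAdef
  have hAmeas : ∀ n, AEMeasurable (A n) P := by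
    intro n
    have : Measurable fun x : Fin n → ℝ => 1 / (n : ℝ) * ∑ j : Fin n,
        (pointQuotient n (m n) x j - g (x j)) ^ 2 :=
      (Finset.measurable_sum _ fun j _ => ((measurable_pointQuotient n (m n) j).sub
        (hg.comp (measurable_pi_apply j))).pow_const 2).const_mul _
    exact this.comp_aemeasurable (hXn n)
  have hAint : Tendsto (fun N => ∫⁻ ω, ENNReal.ofReal (A (N + 1) ω) ∂P) atTop (𝓝 0) := by
    refine tendsto_of_tendsto_of_tendsto_of_le_of_le tendsto_const_nhds
      (tendsto_lintegral_iSup_insertedQuotient hk hk0 hg hg0 μ hμ hfin')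
      (fun _ => zero_le) fun N => ?_
    have hz : ∀ j : Fin (N + 1), Measurable fun x : Fin (N + 1) → ℝ =>
        ENNReal.ofReal ((pointQuotient (N + 1) (k N) x j - g (x j)) ^ 2) := fun j =>
      (((measurable_pointQuotient (N + 1) (k N) j).sub
        (hg.comp (measurable_pi_apply j))).pow_const 2).ennreal_ofReal
    have e : ∀ ω, ENNReal.ofReal (A (N + 1) ω) = ENNReal.ofReal (1 / (N + 1 : ℕ)) *
        ∑ j, ENNReal.ofReal ((pointQuotient (N + 1) (k N) (fun i : Fin (N + 1) => X i ω) j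
          - g (X j ω)) ^ 2) := fun ω => by
      rw [← ENNReal.ofReal_sum_of_nonneg fun j _ => sq_nonneg _,
        ← ENNReal.ofReal_mul (by positivity)]
    have hzX : ∀ j : Fin (N + 1), AEMeasurable (fun ω => ENNReal.ofReal ((pointQuotient (N + 1)
        (k N) (fun i : Fin (N + 1) => X i ω) j - g (X j ω)) ^ 2)) P := fun j =>
      (hz j).comp_aemeasurable (hXn (N + 1))
    simp only [e]
    rw [lintegral_const_mul' _ _ ENNReal.ofReal_ne_top, lintegral_finsetSum' _ fun j _ => hzX j]
    have hj : ∀ j : Fin (N + 1), ∫⁻ ω, ENNReal.ofReal ((pointQuotient (N + 1) (k N)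
        (fun i : Fin (N + 1) => X i ω) j - g (X j ω)) ^ 2) ∂P ≤
        ∫⁻ a, ⨆ j, ∫⁻ y, ENNReal.ofReal ((insertedQuotient N (k N) j a y - g a) ^ 2)
          ∂Measure.pi (fun _ : Fin N => μ) ∂μ := by
      intro j
      refine le_trans (le_of_eq ?_) (lintegral_pointQuotient_sub_sq_le hg μ N (k N) j)
      rw [← hjoint (N + 1), lintegral_map' (hz j).aemeasurable (hXn (N + 1))]
    refine (mul_le_mul_right (Finset.sum_le_card_nsmul _ _ _ fun j _ => hj j) _).trans ?_
    rw [Finset.card_univ, Fintype.card_fin, nsmul_eq_mul, ← mul_assoc, ← ENNReal.ofReal_natCast,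
      ← ENNReal.ofReal_mul (by positivity), one_div, inv_mul_cancel₀ (by positivity),
      ENNReal.ofReal_one, one_mul]
  have hA0 : TendstoInMeasure P A atTop fun _ => 0 := by
    refine tendstoInMeasure_of_ne_top fun ε hε hε' => ?_
    rw [← tendsto_add_atTop_iff_nat 1]
    have hlim : Tendsto (fun N => (∫⁻ ω, ENNReal.ofReal (A (N + 1) ω) ∂P) / ε) atTop (𝓝 0) := by
      simpa using ENNReal.Tendsto.div_const hAint (Or.inr hε.ne')
    refine tendsto_of_tendsto_of_tendsto_of_le_of_le tendsto_const_nhds hlim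
      (fun _ => zero_le) fun N => ?_
    refine le_trans (measure_mono fun ω hω => ?_) (meas_ge_le_lintegral_div
      (hAmeas (N + 1)).ennreal_ofReal hε.ne' hε')
    have h : ε ≤ edist (A (N + 1) ω) 0 := hω
    rw [edist_zero_right, Real.enorm_eq_ofReal (by positivity)] at h
    exact h
  have hind : ∀ h : ℝ → ℝ, Measurable h → Integrable (fun ω => h (X 0 ω)) P →
      ∀ᵐ ω ∂P, Tendsto (fun n : ℕ => (∑ j : Fin n, h (X j ω)) / (n : ℝ)) atTop
        (𝓝 (∫ ω, h (X 0 ω) ∂P)) := by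
    intro h hh hint
    have := strong_law_ae_real (fun i ω => h (X i ω)) hint
      (fun i j hij => (hindep.indepFun hij).comp hh hh) fun i => (hident i).comp hh
    filter_upwards [this] with ω hω
    refine hω.congr fun n => ?_
    rw [Finset.sum_range]
  have hl1 := hind g hg (hL2.integrable one_le_two)
  have hl2 := hind (fun a => g a ^ 2) (hg.pow_const 2) hL2.integrable_sq
  have hvar : varextropy (X 0) P
      = 1 / 4 * (∫ ω, g (X 0 ω) ^ 2 ∂P - (∫ ω, g (X 0 ω) ∂P) ^ 2) := by
    have : varextropy (X 0) P = variance (fun ω => -(1 / 2) * g (X 0 ω)) P := rfl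
    rw [this, variance_const_mul, variance_eq_sub hL2]
    simp only [Pi.pow_apply]
    ring
  have hest : ∀ n, AEStronglyMeasurable
      (fun ω => spacingEstimator n (m n) fun i : Fin n => X i ω) P := by
    intro n
    have hs := fun i => measurable_spacingQuotient n (m n) i
    have : Measurable fun x : Fin n → ℝ => spacingEstimator n (m n) x :=
      ((Finset.measurable_sum _ fun i _ => (hs i).pow_const 2).const_mul _).sub
        ((((Finset.measurable_sum _ fun i _ => hs i).const_mul _).pow_const 2).const_mul _)
    exact (this.comp_aemeasurable (hXn n)).aestronglyMeasurable
  refine (exists_seq_tendstoInMeasure_atTop_iff hest).2 fun ns hns => ?_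
  obtain ⟨ns', hns', hae⟩ := (exists_seq_tendstoInMeasure_atTop_iff
    fun n => (hAmeas n).aestronglyMeasurable).1 hA0 ns hns
  refine ⟨ns', hns', ?_⟩
  have hsub : Tendsto (fun i => ns (ns' i)) atTop atTop :=
    hns.tendsto_atTop.comp hns'.tendsto_atTop
  filter_upwards [hae, hl1, hl2] with ω h0 h1 h2
  have := tendsto_empirical_variance (n := fun i => ns (ns' i))
    (W := fun i j => pointQuotient (ns (ns' i)) (m (ns (ns' i)))
      (fun l : Fin (ns (ns' i)) => X l ω) j)
    (u := fun i j => g (X j ω)) h0 (h1.comp hsub) (h2.comp hsub)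
  rw [hvar]
  refine this.congr fun i => ?_
  rw [spacingEstimator, sum_spacingQuotient _ _ _ (fun q => q ^ 2),
    sum_spacingQuotient _ _ _ fun q => q]
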